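/- Let $(M,g)$ be a smooth Riemannian manifold of dimension $n$, with Levi-Civita connection $\nabla$ and curvature tensor $R(X,Y)Z=\nabla_X\nabla_YZ-\nabla_Y\nabla_XZ-\nabla_{[X,Y]}Z$. Let $\pi:L(M)\to M$ be its frame bundle; a point $u=(u_1,\dots,u_n)\in L(M)$ is a basis of $T_{\pi(u)}M$. Let $R_i:L(M)\to TM$, $R_i(u)=u_i$, and let $K:TTM\to TM$ be the connection map of $\nabla$. For $v\in T_{\pi(u)}M$ let $v^h_u\in T_uL(M)$ be the horizontal lift, i.e. the unique vector with $\pi_*v^h_u=v$ and $K(R_{j*}v^h_u)=0$ for all $j$, and for $1\le i\le n$ let $v^{v,i}_u\in T_uL(M)$ be the $i$-th vertical lift, i.e. the unique vector with $\pi_*v^{v,i}_u=0$, $K(R_{i*}v^{v,i}_u)=v$ and $K(R_{j*}v^{v,i}_u)=0$ for $j\ne i$. For a vector field $X$ on $M$ let $X^h$ and $X^{v,i}$ be the vector fields $u\mapsto (X_{\pi(u)})^h_u$ and $u\mapsto (X_{\pi(u)})^{v,i}_u$ on $L(M)$, and let $U^i_u=(u_i)^{v,i}_u$. Let $\alpha,\beta:[0,\infty)\to\mathbb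 R$ be smooth with $\alpha(t)>0$ and $\alpha(t)+t\beta(t)>0$ for all $t>0$, and let $\bar g$ be the Riemannian metric on $L(M)$ given by \begin{align*} &\bar g(X^h,Y^h)_u=g(X,Y),\qquad \bar g(X^h,Y^{v,i})_u=0,\qquad \bar g(X^{v,i},Y^{v,j})_u=0\quad (i\neq j),\\ &\bar g(X^{v,i},Y^{v,i})_u=\alpha(|u_i|^2)g(X,Y)+\beta(|u_i|^2)g(X,u_i)g(Y,u_i). \end{align*} Write $\alpha_i,\beta_i,\alpha_i',\beta_i'$ for the values of $\alpha,\beta,\alpha',\beta'$ at $|u_i|^2=g(u_i,u_i)$. Then the Levi-Civita connection $\overline\nabla$ of $\bar g$ satisfies, for all smooth vector fields $X,Y$ on $M$, all $u\in L(M)$ and all $i,j\in\{1,\dots,n\}$, \begin{align*} \left(\overline\nabla_{X^{h}}Y^{h}\right)_u &=\left( \nabla_X Y \right)^{h}_u-\frac{1}{2}\sum_{k=1}^n\left(R(X,Y)u_k\right)^{v,k}_u, \\ \left(\overline\nabla_{X^h}Y^{v,i}\right)_u &=\frac{\alpha_i}{2}\left(R(u_i,Y)X\right)_u^h+\left( \nabla_XY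 \right)^{v,i}_u, \\ \left(\overline\nabla_{X^{v,i}}Y^h\right)_u &=\frac{\alpha_i}{2}\left(R(u_i,X)Y\right)_u^h, \\ \left(\overline\nabla_{X^{v,i}}Y^{v,j}\right)_u &=0\quad\text{for } i\neq j,\\ \left(\overline\nabla_{X^{v,i}}Y^{v,i}\right)_u &=\frac{\alpha_i '}{\alpha_i}\left( g(X,u_i)Y^{v,i}_u+g(Y,u_i)X^{v,i}_u \right) \\ &\quad+\left(\frac{\beta_i '\alpha_i-2\alpha_i '\beta_i}{\alpha_i(\alpha_i+|u_i|^2\beta_i)}g(X,u_i)g(Y,u_i)+\frac{\beta_i-\alpha_i '}{\alpha_i+|u_i|^2\beta_i}g(X,Y)\right)U^i_u. \end{align*} -/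

import Mathlib

open Bundle Manifold ContDiff Topology

noncomputable section

/-! ### Levi-Civita connections and curvature -/

/-- `cov` is the Levi-Civita connection of the metric `g`: it is torsion free and compatible
with `g`. As everywhere in Mathlib, `cov Y x (X x)` is `(∇_X Y)_x`. -/
structure IsLeviCivita {E : Type*} [NormedAddCommGroup E] [NormedSpace ℝ E]
    {H : Type*} [TopologicalSpace H] {I : ModelWithCorners ℝ E H}
    {N : Type*} [TopologicalSpace N] [ChartedSpace H N] [IsManifold I 1 N]
    (g : ∀ x : N, TangentSpace I x → TangentSpace I x → ℝ)
    (cov : CovariantDerivative I E (TangentSpace I : N → Type _)) : Prop where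
  torsion_free : ∀ (X Y : ∀ x : N, TangentSpace I x) (x : N),
    MDifferentiableAt I I.tangent (fun y => (⟨y, X y⟩ : TangentBundle I N)) x →
    MDifferentiableAt I I.tangent (fun y => (⟨y, Y y⟩ : TangentBundle I N)) x →
    cov Y x (X x) - cov X x (Y x) = VectorField.mlieBracket I X Y x
  metric : ∀ (Y Z : ∀ x : N, TangentSpace I x) (x : N) (v : TangentSpace I x),
    MDifferentiableAt I I.tangent (fun y => (⟨y, Y y⟩ : TangentBundle I N)) x →
    MDifferentiableAt I I.tangent (fun y => (⟨y, Z y⟩ : TangentBundle I N)) x →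
    (mfderiv I 𝓘(ℝ, ℝ) (fun y => g y (Y y) (Z y)) x v : ℝ) =
      g x (cov Y x v) (Z x) + g x (Y x) (cov Z x v)

/-- The curvature tensor `R(v, w) z = ∇_V ∇_W Z - ∇_W ∇_V Z - ∇_[V, W] Z` at `x`, where `V, W, Z`
are the local extensions of `v, w, z` with constant components in the preferred chart at `x`
(the value does not depend on the choice of smooth local extensions). -/
def curvatureAt {E : Type*} [NormedAddCommGroup E] [NormedSpace ℝ E]
    {H : Type*} [TopologicalSpace H] {I : ModelWithCorners ℝ E H}
    {N : Type*} [TopologicalSpace N] [ChartedSpace H N] [IsManifold I 1 N]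
    (cov : CovariantDerivative I E (TangentSpace I : N → Type _)) (x : N)
    (v w z : TangentSpace I x) : TangentSpace I x :=
  let V : ∀ y : N, TangentSpace I y := FiberBundle.extend E v
  let W : ∀ y : N, TangentSpace I y := FiberBundle.extend E w
  let Z : ∀ y : N, TangentSpace I y := FiberBundle.extend E z
  cov (fun y => cov Z y (W y)) x v - cov (fun y => cov Z y (V y)) x w
    - cov Z x (VectorField.mlieBracket I V W x)

/-! ### The frame bundle as a manifold

A frame `(u_1, ..., u_n)` of `T_x M` is regarded as the linear isomorphism `ℝ^n → T_x M` sending the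
canonical basis to it. Thus `L(M)` is an open subset of the total space of the vector bundle
`Hom(ℝ^n, TM)`, and it carries the corresponding manifold structure. -/

abbrev FrameHomFiber (n : ℕ) (M : Type*) [TopologicalSpace M]
    [ChartedSpace (EuclideanSpace ℝ (Fin n)) M] (x : M) : Type :=
  Bundle.Trivial M (EuclideanSpace ℝ (Fin n)) x →L[ℝ] TangentSpace (𝓡 n) x

abbrev FrameHomBundle (n : ℕ) (M : Type*) [TopologicalSpace M]
    [ChartedSpace (EuclideanSpace ℝ (Fin n)) M] : Type _ :=
  TotalSpace (EuclideanSpace ℝ (Fin n) →L[ℝ] EuclideanSpace ℝ (Fin n)) (FrameHomFiber n M)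

/-- The model vector space of the frame bundle. -/
abbrev FrameModel (n : ℕ) : Type :=
  EuclideanSpace ℝ (Fin n) × (EuclideanSpace ℝ (Fin n) →L[ℝ] EuclideanSpace ℝ (Fin n))

/-- The model with corners of the frame bundle. -/
abbrev frameI (n : ℕ) :=
  (𝓡 n).prod 𝓘(ℝ, EuclideanSpace ℝ (Fin n) →L[ℝ] EuclideanSpace ℝ (Fin n))

section
variable {n : ℕ} {M : Type*} [TopologicalSpace M]
  [ChartedSpace (EuclideanSpace ℝ (Fin n)) M] [IsManifold (𝓡 n) ∞ M]

theorem isOpen_frames : IsOpen {p : FrameHomBundle n M | p.2.IsInvertible} := by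
  rw [isOpen_iff_mem_nhds]
  intro p hp
  set e := trivializationAt (EuclideanSpace ℝ (Fin n) →L[ℝ] EuclideanSpace ℝ (Fin n))
    (FrameHomFiber n M) p.1 with he
  have hs : p ∈ e.source := by
    rw [e.mem_source]; exact mem_baseSet_trivializationAt _ _ _
  have key : ∀ q ∈ e.source, (q.2.IsInvertible ↔ (e q).2 ∈ Set.range
      ((↑) : (EuclideanSpace ℝ (Fin n) ≃L[ℝ] EuclideanSpace ℝ (Fin n)) → _)) := by
    intro q hq
    rw [he, hom_trivializationAt_apply]
    have h1 : q.1 ∈ (trivializationAt (EuclideanSpace ℝ (Fin n))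
      (Bundle.Trivial M (EuclideanSpace ℝ (Fin n))) p.1).baseSet := hq.1
    have h2 : q.1 ∈ (trivializationAt (EuclideanSpace ℝ (Fin n))
      (TangentSpace (𝓡 n) : M → Type _) p.1).baseSet := hq.2
    rw [ContinuousLinearMap.inCoordinates_eq h1 h2]
    change _ ↔ ContinuousLinearMap.IsInvertible _
    simp
  have ho : IsOpen (e.source ∩ e ⁻¹' (Set.univ ×ˢ Set.range
      ((↑) : (EuclideanSpace ℝ (Fin n) ≃L[ℝ] EuclideanSpace ℝ (Fin n)) → _))) :=
    e.toOpenPartialHomeomorph.isOpen_inter_preimage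
      (isOpen_univ.prod ContinuousLinearEquiv.isOpen)
  refine Filter.mem_of_superset (ho.mem_nhds ⟨hs, ⟨trivial, (key p hs).1 hp⟩⟩) ?_
  rintro q ⟨hq, -, hq2⟩
  exact (key q hq).2 hq2

variable (n M) in
/-- The set of frames. -/
def frameOpens : TopologicalSpace.Opens (FrameHomBundle n M) :=
  ⟨{p | p.2.IsInvertible}, isOpen_frames⟩

variable (n M) in
/-- The frame bundle `L(M)`. -/
abbrev FrameBundle : Type _ := ↥(frameOpens n M)

namespace FrameBundle

/-- The projection `π : L(M) → M`. -/
def proj (u : FrameBundle n M) : M := u.1.1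

/-- The `i`-th vector `u_i` of the frame `u`. -/
def vec (u : FrameBundle n M) (i : Fin n) : TangentSpace (𝓡 n) u.proj :=
  u.1.2 (EuclideanSpace.single i (1 : ℝ))

/-- The map `R_i : L(M) → TM`, `R_i u = u_i`. -/
def toTangent (i : Fin n) (u : FrameBundle n M) : TangentBundle (𝓡 n) M :=
  ⟨u.proj, u.vec i⟩

instance : IsManifold (frameI n) ∞ (FrameBundle n M) :=
  TopologicalSpace.Opens.instIsManifoldSubtypeMem _

instance : IsManifold (frameI n) 1 (FrameBundle n M) :=
  IsManifold.of_le (n := ∞) (by simp)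

instance : IsManifold (frameI n) 2 (FrameBundle n M) :=
  IsManifold.of_le (n := ∞) (by norm_cast)
end FrameBundle

/-- The connection map `K : TTM → TM` of `cov`. In the bundle chart induced by a chart of `M`,
`K A = ∑ j, A(v^j) ∂_j + v^j ∇_{π_* A} ∂_j` for `A` tangent at `v = ∑ j, v^j ∂_j`; the vector field
`∑ j, v^j ∂_j` with constant `v^j` is `FiberBundle.extend`. -/
def connectionMap
    (cov : CovariantDerivative (𝓡 n) (EuclideanSpace ℝ (Fin n))
      (TangentSpace (𝓡 n) : M → Type _))
    (ζ : TangentBundle (𝓡 n) M) :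
    TangentSpace (𝓡 n).tangent ζ →L[ℝ] TangentSpace (𝓡 n) ζ.1 :=
  let e := trivializationAt (EuclideanSpace ℝ (Fin n)) (TangentSpace (𝓡 n) : M → Type _) ζ.1
  (e.symmL ℝ ζ.1).comp (mfderiv (𝓡 n).tangent 𝓘(ℝ, EuclideanSpace ℝ (Fin n))
    (fun η : TangentBundle (𝓡 n) M => (e η).2) ζ) +
  (cov (FiberBundle.extend (EuclideanSpace ℝ (Fin n)) ζ.2) ζ.1).comp
    (mfderiv (𝓡 n).tangent (𝓡 n) (fun η : TangentBundle (𝓡 n) M => η.1) ζ)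

namespace FrameBundle

/-- The map `A ↦ (π_* A, (K (R_i)_* A)_i)`. -/
def splitMap (cov : CovariantDerivative (𝓡 n) (EuclideanSpace ℝ (Fin n))
      (TangentSpace (𝓡 n) : M → Type _))
  (u : FrameBundle n M) :
  TangentSpace (frameI n) u →ₗ[ℝ] TangentSpace (𝓡 n) u.proj ×
    (Fin n → TangentSpace (𝓡 n) u.proj) :=
  (mfderiv (frameI n) (𝓡 n) proj u).toLinearMap.prod
    (LinearMap.pi fun i => ((connectionMap cov (toTangent i u)).comp
      (mfderiv (frameI n) (𝓡 n).tangent (toTangent i) u)).toLinearMap)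

theorem contMDiff_toTangent (i : Fin n) :
    ContMDiff (frameI n) (𝓡 n).tangent ∞ (toTangent i : FrameBundle n M → _) := by
  have h0 : ContMDiff (frameI n) (frameI n) ∞ (Subtype.val : FrameBundle n M → _) :=
    contMDiff_subtype_val
  have hproj : ContMDiff (frameI n) (𝓡 n) ∞ (proj : FrameBundle n M → M) :=
    (contMDiff_proj (FrameHomFiber n M)).comp h0
  have hv : ContMDiff (frameI n) ((𝓡 n).prod 𝓘(ℝ, EuclideanSpace ℝ (Fin n))) ∞
      (fun w : FrameBundle n M => TotalSpace.mk' (EuclideanSpace ℝ (Fin n))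
        (E := Bundle.Trivial M (EuclideanSpace ℝ (Fin n))) w.proj
        (EuclideanSpace.single i (1 : ℝ))) := by
    intro w
    rw [contMDiffAt_totalSpace]
    exact ⟨hproj w, contMDiffAt_const⟩
  exact ContMDiff.clm_bundle_apply (F₁ := EuclideanSpace ℝ (Fin n))
    (E₁ := Bundle.Trivial M (EuclideanSpace ℝ (Fin n))) (F₂ := EuclideanSpace ℝ (Fin n))
    (E₂ := (TangentSpace (𝓡 n) : M → Type _)) (b := proj) (ϕ := fun w => w.1.2) h0 hv

set_option maxHeartbeats 1000000 in
theorem splitMap_injective (cov : CovariantDerivative (𝓡 n) (EuclideanSpace ℝ (Fin n))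
      (TangentSpace (𝓡 n) : M → Type _))
  (u : FrameBundle n M) : Function.Injective (splitMap cov u) := by
  rw [← LinearMap.ker_eq_bot, LinearMap.ker_eq_bot']
  intro A hA
  have h1 : mfderiv (frameI n) (𝓡 n) proj u A = 0 := congrArg Prod.fst hA
  have h2 : ∀ i, connectionMap cov (toTangent i u)
      (mfderiv (frameI n) (𝓡 n).tangent (toTangent i) u A) = 0 :=
    fun i => congrFun (congrArg Prod.snd hA) i
  -- the inclusion and its trivialisation
  set x := u.proj with hx
  set e := trivializationAt (EuclideanSpace ℝ (Fin n) →L[ℝ] EuclideanSpace ℝ (Fin n))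
    (FrameHomFiber n M) x with he
  set e' := trivializationAt (EuclideanSpace ℝ (Fin n)) (TangentSpace (𝓡 n) : M → Type _) x with he'
  have hproj : ContMDiff (frameI n) (𝓡 n) ∞ (proj : FrameBundle n M → M) :=
    (contMDiff_proj (FrameHomFiber n M)).comp contMDiff_subtype_val
  have hvec : ∀ i, ContMDiff (frameI n) (𝓡 n).tangent ∞ (toTangent i : FrameBundle n M → _) := by
    intro i
    exact contMDiff_toTangent i
  have hR : ∀ i, MDifferentiableAt (frameI n) (𝓡 n).tangent (toTangent i) u :=
    fun i => (hvec i).contMDiffAt.mdifferentiableAt (by simp)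
  have hxe : x ∈ e'.baseSet := mem_baseSet_trivializationAt _ _ _
  have hue : u.1 ∈ e.source := by
    rw [e.mem_source]; exact mem_baseSet_trivializationAt _ _ _
  -- coordinates of the frame
  let ψ : FrameBundle n M → (EuclideanSpace ℝ (Fin n) →L[ℝ] EuclideanSpace ℝ (Fin n)) :=
    fun w => (e w.1).2
  have hψ : MDifferentiableAt (frameI n) 𝓘(ℝ, EuclideanSpace ℝ (Fin n) →L[ℝ] EuclideanSpace ℝ (Fin n)) ψ u := by
    have h0 : ContMDiffAt (frameI n) (frameI n) ∞ (Subtype.val : FrameBundle n M → _) u :=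
      contMDiff_subtype_val u
    exact ((contMDiffAt_totalSpace.1 h0).2).mdifferentiableAt (by simp)
  have hloc : ∀ᶠ w : FrameBundle n M in 𝓝 u, w.1 ∈ e.source :=
    continuous_subtype_val.continuousAt.eventually (e.open_source.mem_nhds hue)
  have hcoord : ∀ i, ∀ᶠ w : FrameBundle n M in 𝓝 u,
      (e' (toTangent i w)).2 = ψ w (EuclideanSpace.single i 1) := by
    intro i
    filter_upwards [hloc] with w hw
    have h1 : w.1.1 ∈ (trivializationAt (EuclideanSpace ℝ (Fin n))
      (Bundle.Trivial M (EuclideanSpace ℝ (Fin n))) x).baseSet := hw.1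
    have h2 : w.1.1 ∈ e'.baseSet := hw.2
    change _ = (ContinuousLinearMap.inCoordinates _ _ _ _ x w.1.1 x w.1.1 w.1.2) _
    rw [ContinuousLinearMap.inCoordinates_eq h1 h2]
    simp [toTangent, vec, proj]
    rfl
  let dψ : TangentSpace (frameI n) u →L[ℝ] (EuclideanSpace ℝ (Fin n) →L[ℝ] EuclideanSpace ℝ (Fin n)) :=
    mfderiv (frameI n) 𝓘(ℝ, EuclideanSpace ℝ (Fin n) →L[ℝ] EuclideanSpace ℝ (Fin n)) ψ u
  have hdψ : ∀ i, dψ A (EuclideanSpace.single i 1) = 0 := by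
    intro i
    have hT : MDifferentiableAt (𝓡 n).tangent (𝓡 n).tangent (id : TangentBundle (𝓡 n) M → _)
        (toTangent i u) := mdifferentiableAt_id
    have he'd : MDifferentiableAt (𝓡 n).tangent 𝓘(ℝ, EuclideanSpace ℝ (Fin n))
        (fun η : TangentBundle (𝓡 n) M => (e' η).2) (toTangent i u) :=
      (mdifferentiableAt_totalSpace (𝓡 n) _ |>.1 hT).2
    have hp : MDifferentiableAt (𝓡 n).tangent (𝓡 n)
        (fun η : TangentBundle (𝓡 n) M => η.1) (toTangent i u) :=
      (mdifferentiableAt_totalSpace (𝓡 n) _ |>.1 hT).1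
    have hb : mfderiv (𝓡 n).tangent (𝓡 n) (fun η : TangentBundle (𝓡 n) M => η.1) (toTangent i u)
        (mfderiv (frameI n) (𝓡 n).tangent (toTangent i) u A) = 0 := by
      have := mfderiv_comp u hp (hR i)
      exact (congrArg (fun L => L A) this).symm.trans h1
    have h3 := h2 i
    unfold connectionMap at h3
    simp only [add_apply, ContinuousLinearMap.comp_apply] at h3
    have h4 : (e'.symmL ℝ x) (mfderiv (𝓡 n).tangent 𝓘(ℝ, EuclideanSpace ℝ (Fin n))
        (fun η : TangentBundle (𝓡 n) M => (e' η).2) (toTangent i u)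
        (mfderiv (frameI n) (𝓡 n).tangent (toTangent i) u A)) = 0 := by
      rw [hb, map_zero, add_zero] at h3
      exact h3
    have h5 : mfderiv (𝓡 n).tangent 𝓘(ℝ, EuclideanSpace ℝ (Fin n))
        (fun η : TangentBundle (𝓡 n) M => (e' η).2) (toTangent i u)
        (mfderiv (frameI n) (𝓡 n).tangent (toTangent i) u A) = 0 := by
      have := congrArg (e'.continuousLinearMapAt ℝ x) h4
      rw [map_zero] at this
      exact (e'.continuousLinearMapAt_symmL (R := ℝ) hxe _).symm.trans this
    have h6 : HasMFDerivAt (frameI n) 𝓘(ℝ, EuclideanSpace ℝ (Fin n))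
        (fun w => (e' (toTangent i w)).2) u _ :=
      HasMFDerivAt.comp (I' := (𝓡 n).tangent)
        (g := fun η : TangentBundle (𝓡 n) M => (e' η).2) (f := toTangent i) u he'd.hasMFDerivAt (hR i).hasMFDerivAt
    have h7 : HasMFDerivAt (frameI n) 𝓘(ℝ, EuclideanSpace ℝ (Fin n))
        (fun w => ψ w (EuclideanSpace.single i (1 : ℝ))) u
        ((ContinuousLinearMap.apply ℝ (EuclideanSpace ℝ (Fin n))
          (EuclideanSpace.single i (1 : ℝ))).comp dψ) :=
      HasMFDerivAt.comp (I' := 𝓘(ℝ, EuclideanSpace ℝ (Fin n) →L[ℝ] EuclideanSpace ℝ (Fin n))) u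
        (ContinuousLinearMap.apply ℝ (EuclideanSpace ℝ (Fin n))
          (EuclideanSpace.single i (1 : ℝ))).hasMFDerivAt hψ.hasMFDerivAt
    have h8 := hasMFDerivAt_unique (h6.congr_of_eventuallyEq
      ((hcoord i).mono fun _ h => h.symm)) h7
    exact (congrArg (fun L => L A) h8).symm.trans h5
  have hdψ0 : dψ A = 0 := by
    refine ContinuousLinearMap.coe_injective ?_
    refine (EuclideanSpace.basisFun (Fin n) ℝ).toBasis.ext fun i => ?_
    simpa using hdψ i
  -- the chart at `u` is built from the projection and the coordinates of the frame
  have hφ : ∀ᶠ w : FrameBundle n M in 𝓝 u, extChartAt (frameI n) u w =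
      (extChartAt (𝓡 n) x w.proj, ψ w) := by
    filter_upwards [hloc] with w hw
    have h9 : extChartAt (frameI n) u w = extChartAt (frameI n) u.1 w.1 := rfl
    rw [h9, FiberBundle.extChartAt]
    have h10 : (e w.1).1 = w.1.1 := e.coe_fst hw
    change (extChartAt (𝓡 n) x (e w.1).1, (e w.1).2) = _
    rw [h10]; rfl
  have hd : HasMFDerivAt (frameI n) 𝓘(ℝ, FrameModel n) (fun w : FrameBundle n M =>
      (extChartAt (𝓡 n) x w.proj, ψ w)) u (((mfderiv (𝓡 n) 𝓘(ℝ, EuclideanSpace ℝ (Fin n)) (extChartAt (𝓡 n) x) x).comp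
        (mfderiv (frameI n) (𝓡 n) proj u)).prod dψ) := by
    have hx' : MDifferentiableAt (𝓡 n) 𝓘(ℝ, EuclideanSpace ℝ (Fin n)) (extChartAt (𝓡 n) x) x :=
      mdifferentiableAt_extChartAt (mem_chart_source _ x)
    have h11 : MDifferentiableAt (frameI n) (𝓡 n) (proj : FrameBundle n M → M) u :=
      (hproj.contMDiffAt).mdifferentiableAt (by simp)
    have h12 := (hx'.hasMFDerivAt.comp u h11.hasMFDerivAt)
    have h13 := h12.prodMk hψ.hasMFDerivAt
    rw [← modelWithCornersSelf_prod] at h13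
    exact h13
  have hinv := isInvertible_mfderiv_extChartAt (I := frameI n) (mem_extChartAt_source (I := frameI n) u)
  have hder := (hd.congr_of_eventuallyEq hφ).mfderiv
  have hA0 : mfderiv (frameI n) 𝓘(ℝ, FrameModel n) (extChartAt (frameI n) u) u A = 0 := by
    rw [hder]
    refine Prod.ext ?_ hdψ0
    change mfderiv (𝓡 n) 𝓘(ℝ, EuclideanSpace ℝ (Fin n)) (extChartAt (𝓡 n) x) x
      (mfderiv (frameI n) (𝓡 n) proj u A) = 0
    exact (congrArg _ h1).trans (map_zero _)
  obtain ⟨f, hf⟩ := hinv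
  apply f.injective
  rw [map_zero]
  exact (congrArg (fun L => L A) hf).trans hA0

/-- The decomposition `T_u L(M) = H ⊕ V^1 ⊕ ... ⊕ V^n`, with the horizontal space `H` and every `V^i`
identified with `T_x M`: the isomorphism `A ↦ (π_* A, (K (R_i)_* A)_i)`. -/
def split (cov : CovariantDerivative (𝓡 n) (EuclideanSpace ℝ (Fin n))
      (TangentSpace (𝓡 n) : M → Type _))
  (u : FrameBundle n M) :
  TangentSpace (frameI n) u ≃ₗ[ℝ] TangentSpace (𝓡 n) u.proj ×
    (Fin n → TangentSpace (𝓡 n) u.proj) :=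
  LinearEquiv.ofBijective (splitMap cov u) ⟨splitMap_injective cov u, by
    have h : Module.finrank ℝ (FrameModel n) = Module.finrank ℝ
      (EuclideanSpace ℝ (Fin n) × (Fin n → EuclideanSpace ℝ (Fin n))) := by
      rw [Module.finrank_prod, Module.finrank_prod,
        ← LinearMap.toContinuousLinearMap.finrank_eq, Module.finrank_linearMap,
        Module.finrank_pi_fintype]
      simp
    exact (LinearMap.injective_iff_surjective_of_finrank_eq_finrank (V := FrameModel n)
      (V₂ := EuclideanSpace ℝ (Fin n) × (Fin n → EuclideanSpace ℝ (Fin n))) h).1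
      (splitMap_injective cov u)⟩

/-- The horizontal lift `v^h` of `v` to `u`: the vector `A` with `π_* A = v` and `K (R_j)_* A = 0`
for all `j`, that is, `(R_j)_* A` is the horizontal lift of `v` to `T TM`. -/
def hLift (cov : CovariantDerivative (𝓡 n) (EuclideanSpace ℝ (Fin n))
      (TangentSpace (𝓡 n) : M → Type _))
    (u : FrameBundle n M) (v : TangentSpace (𝓡 n) u.proj) : TangentSpace (frameI n) u :=
  (split cov u).symm (v, 0)

/-- The vertical lift `v^{v,i}` of `v` to `u`: the vector `A` with `π_* A = 0`, `K (R_i)_* A = v`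
and `K (R_j)_* A = 0` for `j ≠ i`, that is, `(R_i)_* A` is the vertical lift of `v` to `T TM` and
`(R_j)_* A = 0` for `j ≠ i`. -/
def vLift (cov : CovariantDerivative (𝓡 n) (EuclideanSpace ℝ (Fin n))
      (TangentSpace (𝓡 n) : M → Type _))
    (i : Fin n) (u : FrameBundle n M) (v : TangentSpace (𝓡 n) u.proj) :
    TangentSpace (frameI n) u :=
  (split cov u).symm (0, Pi.single i v)

/-- The horizontal lift `X^h` of a vector field `X`. -/
def hField (cov : CovariantDerivative (𝓡 n) (EuclideanSpace ℝ (Fin n))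
      (TangentSpace (𝓡 n) : M → Type _))
    (X : ∀ x : M, TangentSpace (𝓡 n) x) (u : FrameBundle n M) : TangentSpace (frameI n) u :=
  hLift cov u (X u.proj)

/-- The vertical lift `X^{v,i}` of a vector field `X`. -/
def vField (cov : CovariantDerivative (𝓡 n) (EuclideanSpace ℝ (Fin n))
      (TangentSpace (𝓡 n) : M → Type _))
    (i : Fin n) (X : ∀ x : M, TangentSpace (𝓡 n) x) (u : FrameBundle n M) :
    TangentSpace (frameI n) u :=
  vLift cov i u (X u.proj)

/-- The canonical vertical vector field `U^i`, `U^i_u = u_i^{v,i}`. -/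
def canonicalField (cov : CovariantDerivative (𝓡 n) (EuclideanSpace ℝ (Fin n))
      (TangentSpace (𝓡 n) : M → Type _))
    (i : Fin n) (u : FrameBundle n M) : TangentSpace (frameI n) u :=
  vLift cov i u (u.vec i)

/-! ### The metric on the frame bundle -/

/-- `|u_i|^2`. -/
def normSq (g : ContMDiffRiemannianMetric (𝓡 n) ∞ (EuclideanSpace ℝ (Fin n))
      (TangentSpace (𝓡 n) : M → Type _))
    (u : FrameBundle n M) (i : Fin n) : ℝ :=
  g.inner u.proj (u.vec i) (u.vec i)

/-- The metric `ḡ` on `L(M)`: `π_*` restricts to an isometry on `H`, the distributions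
`H, V^1, ..., V^n` are mutually orthogonal, and
`ḡ(v^{v,i}, w^{v,i}) = α(|u_i|^2) g(v, w) + β(|u_i|^2) g(v, u_i) g(w, u_i)`. -/
def metric (g : ContMDiffRiemannianMetric (𝓡 n) ∞ (EuclideanSpace ℝ (Fin n))
      (TangentSpace (𝓡 n) : M → Type _))
    (cov : CovariantDerivative (𝓡 n) (EuclideanSpace ℝ (Fin n))
      (TangentSpace (𝓡 n) : M → Type _))
    (α β : ℝ → ℝ) (u : FrameBundle n M) (A B : TangentSpace (frameI n) u) : ℝ :=
  g.inner u.proj (split cov u A).1 (split cov u B).1 +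
    ∑ i, (α (normSq g u i) * g.inner u.proj ((split cov u A).2 i) ((split cov u B).2 i) +
      β (normSq g u i) * (g.inner u.proj ((split cov u A).2 i) (u.vec i) *
        g.inner u.proj ((split cov u B).2 i) (u.vec i)))

section
variable (g : ContMDiffRiemannianMetric (𝓡 n) ∞ (EuclideanSpace ℝ (Fin n))
      (TangentSpace (𝓡 n) : M → Type _))
    (cov : CovariantDerivative (𝓡 n) (EuclideanSpace ℝ (Fin n))
      (TangentSpace (𝓡 n) : M → Type _))
    (α β : ℝ → ℝ) (u : FrameBundle n M) (v w : TangentSpace (𝓡 n) u.proj)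

theorem metric_hLift_hLift :
    metric g cov α β u (hLift cov u v) (hLift cov u w) = g.inner u.proj v w := by
  simp [metric, hLift]

theorem metric_hLift_vLift (i : Fin n) :
    metric g cov α β u (hLift cov u v) (vLift cov i u w) = 0 := by
  simp [metric, hLift, vLift]

theorem metric_vLift_vLift_of_ne {i j : Fin n} (hij : i ≠ j) :
    metric g cov α β u (vLift cov i u v) (vLift cov j u w) = 0 := by
  simp only [metric, vLift, LinearEquiv.apply_symm_apply, map_zero, zero_add]
  refine Finset.sum_eq_zero fun k _ => ?_
  rcases eq_or_ne k i with rfl | hk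
  · simp [Pi.single_eq_of_ne hij]
  · simp [Pi.single_eq_of_ne hk]

theorem metric_vLift_vLift (i : Fin n) :
    metric g cov α β u (vLift cov i u v) (vLift cov i u w) =
      α (normSq g u i) * g.inner u.proj v w +
        β (normSq g u i) * (g.inner u.proj v (u.vec i) * g.inner u.proj w (u.vec i)) := by
  simp only [metric, vLift, LinearEquiv.apply_symm_apply, map_zero, zero_add]
  rw [Finset.sum_eq_single i]
  · simp
  · intro k _ hk
    simp [Pi.single_eq_of_ne hk]
  · simp

end

end FrameBundle
end

end

/-!
The Levi-Civita connection of `ḡ` is determined by the Koszul formula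
`2 ḡ(∇_A B, C) = A ḡ(B, C) + B ḡ(A, C) - C ḡ(A, B) + ḡ([A, B], C) - ḡ([A, C], B) - ḡ([B, C], A)`,
and it suffices to test it on horizontal and vertical lifts `C` of vector fields, because these span
every tangent space of `L(M)` and `ḡ` is nondegenerate (`FrameBundle.nablaBar_eq`). Two computations
feed the formula.

* The brackets of lifts: `[X^h, Y^h] = [X, Y]^h - ∑ k, (R(X, Y) u_k)^{v,k}`,
  `[X^h, Y^{v,i}] = (∇_X Y)^{v,i}` and `[X^{v,i}, Y^{v,j}] = 0`
  (`FrameBundle.split_mlieBracket_hField_hField` and the two lemmas after it).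
* The derivatives of `ḡ` on lifts. A tangent vector `A` of `L(M)` at `u` decomposes into
  `a = π_* A` and `κ_i = K (R_i)_* A`. Along `A` the derivative of `g(Y, Z)` is
  `g(∇_a Y, Z) + g(Y, ∇_a Z)`, that of `g(Y, u_i)` is `g(∇_a Y, u_i) + g(Y, κ_i)`, and that of
  `|u_i|^2` is `2 g(κ_i, u_i)`; all three are cases of `FrameBundle.hasMFDerivAt_inner`.

In the resulting expressions the derivatives `∇_a Z` of the test field cancel. The skew-symmetry of
`R(X, Y)` kills the terms `β g(R(X, Y) u_i, u_i)`, and the pair symmetry turns `g(R(X, Z) u_i, Y)`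
into `g(R(u_i, Y) X, Z)`. The derivative of `Y^h` along `X^{v,i}` follows from the one of `X^{v,i}`
along `Y^h` since the torsion vanishes.

Both computations are made in the chart of `L(M)` at `u` induced by the chart of `M` at `π(u)`; its
points are pairs `(p, ψ)` of a point `p` of `ℝ^n` and an endomorphism `ψ` of `ℝ^n` whose columns are
the components of the frame vectors. There the horizontal lift of `a` is `(a, -Γ(a) ∘ ψ)` and the
`i`-th vertical lift of `b` is `(0, b ⊗ e_i^*)` (`hRep`, `vRep`), where `Γ` are the Christoffel
symbols of `g`. That `∇` has Christoffel symbols `Γ` at every point of the chart domain, and that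
the connection map has the expected expression there, follow from the uniqueness of the symmetric
symbols compatible with a metric (`IsMetricOn.eq_christoffel`, `coordL_connectionMap`). The
symmetries of the curvature are proved for a metric on an open subset of a vector space.
-/

noncomputable section

set_option maxSynthPendingDepth 3

section InstanceShortcuts

/-! ### Instance shortcuts for the frame bundle

The general instances for total spaces and open submanifolds are found here once and for all. -/

variable {n : ℕ} {M : Type*} [TopologicalSpace M]
  [ChartedSpace (EuclideanSpace ℝ (Fin n)) M] [IsManifold (𝓡 n) ∞ M]

theorem isManifold_frameBundle : IsManifold (frameI n) 1 (FrameBundle n M) := inferInstance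

/-- The topology of the tangent bundle of `M`. -/
abbrev tangentTopology : TopologicalSpace (TangentBundle (𝓡 n) M) := inferInstance

/-- The topology of the frame bundle. -/
abbrev frameTopology : TopologicalSpace (FrameBundle n M) := inferInstance

/-- The manifold structure of the frame bundle. -/
abbrev frameChartedSpace : ChartedSpace (ModelProd (EuclideanSpace ℝ (Fin n))
  (EuclideanSpace ℝ (Fin n) →L[ℝ] EuclideanSpace ℝ (Fin n))) (FrameBundle n M) := inferInstance

/-- The topology of the tangent bundle of the frame bundle. -/
abbrev frameTangentTopology :
    TopologicalSpace (TangentBundle (frameI n) (FrameBundle n M)) := inferInstance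

end InstanceShortcuts

attribute [local instance] isManifold_frameBundle tangentTopology frameTopology
  frameChartedSpace frameTangentTopology

/-! ### The Levi-Civita connection of a metric on an open subset of a vector space -/

section Coordinates

variable {E : Type*} [NormedAddCommGroup E] [NormedSpace ℝ E]

theorem fderiv_bilin_apply {F : Type*} [NormedAddCommGroup F] [NormedSpace ℝ F]
    {G : F → E →L[ℝ] E →L[ℝ] ℝ} {V W : F → E} {p : F} (hG : DifferentiableAt ℝ G p)
    (hV : DifferentiableAt ℝ V p) (hW : DifferentiableAt ℝ W p) (v : F) :
    fderiv ℝ (fun q => G q (V q) (W q)) p v = fderiv ℝ G p v (V p) (W p) +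
      G p (fderiv ℝ V p v) (W p) + G p (V p) (fderiv ℝ W p v) := by
  have hd := (hG.hasFDerivAt.clm_apply hV.hasFDerivAt).clm_apply hW.hasFDerivAt
  rw [hd.fderiv]
  simp only [add_apply, ContinuousLinearMap.comp_apply, ContinuousLinearMap.flip_apply]
  ring

/-- `G` is a smooth Riemannian metric on the open subset `U` of the vector space `E`. -/
structure IsMetricOn (G : E → E →L[ℝ] E →L[ℝ] ℝ) (U : Set E) : Prop where
  isOpen : IsOpen U
  contDiffOn : ContDiffOn ℝ ∞ G U
  symm : ∀ p ∈ U, ∀ a b, G p a b = G p b a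
  pos : ∀ p ∈ U, ∀ a, a ≠ 0 → 0 < G p a a

/-- The Christoffel symbols of the first kind,
`S_p(a, b, c) = (D_a G(b, c) + D_b G(a, c) - D_c G(a, b)) / 2`. -/
def christoffelFirst (G : E → E →L[ℝ] E →L[ℝ] ℝ) (p : E) : E →L[ℝ] E →L[ℝ] E →L[ℝ] ℝ :=
  (1 / 2 : ℝ) • (fderiv ℝ G p + (fderiv ℝ G p).flip -
    ((ContinuousLinearMap.flipₗᵢ ℝ E E ℝ).toContinuousLinearEquiv :
      (E →L[ℝ] E →L[ℝ] ℝ) →L[ℝ] (E →L[ℝ] E →L[ℝ] ℝ)).comp (fderiv ℝ G p).flip)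

theorem christoffelFirst_apply (G : E → E →L[ℝ] E →L[ℝ] ℝ) (p a b c : E) :
    christoffelFirst G p a b c =
      1 / 2 * (fderiv ℝ G p a b c + fderiv ℝ G p b a c - fderiv ℝ G p c a b) := by
  simp [christoffelFirst]

/-- The Christoffel symbols of the metric `G`: `christoffel G p a b` is `Γ_p(a, b)`, so that
`∇_a b = D_a b + Γ(a, b)`. -/
def christoffel (G : E → E →L[ℝ] E →L[ℝ] ℝ) (p : E) : E →L[ℝ] E →L[ℝ] E :=
  (ContinuousLinearMap.compL ℝ E (E →L[ℝ] ℝ) E (G p).inverse).comp (christoffelFirst G p)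

/-- The curvature in terms of the Christoffel symbols `Γ`:
`R(a, b) = D_a Γ(b) - D_b Γ(a) + [Γ(a), Γ(b)]`. -/
def riemann (Γ : E → E →L[ℝ] E →L[ℝ] E) (p a b : E) : E →L[ℝ] E :=
  fderiv ℝ Γ p a b - fderiv ℝ Γ p b a + (Γ p a).comp (Γ p b) - (Γ p b).comp (Γ p a)

theorem riemann_apply (Γ : E → E →L[ℝ] E →L[ℝ] E) (p a b c : E) :
    riemann Γ p a b c =
      fderiv ℝ Γ p a b c - fderiv ℝ Γ p b a c + Γ p a (Γ p b c) - Γ p b (Γ p a c) := rfl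

namespace IsMetricOn

variable {G : E → E →L[ℝ] E →L[ℝ] ℝ} {U : Set E} {p : E}

theorem eventually_mem (h : IsMetricOn G U) (hp : p ∈ U) : ∀ᶠ q in 𝓝 p, q ∈ U :=
  h.isOpen.mem_nhds hp

theorem contDiffAt (h : IsMetricOn G U) (hp : p ∈ U) : ContDiffAt ℝ ∞ G p :=
  h.contDiffOn.contDiffAt (h.isOpen.mem_nhds hp)

theorem differentiableAt (h : IsMetricOn G U) (hp : p ∈ U) : DifferentiableAt ℝ G p :=
  (h.contDiffAt hp).differentiableAt (by simp)

theorem ext_inner (h : IsMetricOn G U) (hp : p ∈ U) {a b : E}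
    (hab : ∀ c, G p a c = G p b c) : a = b := by
  by_contra hne
  have := h.pos p hp (a - b) (sub_ne_zero.2 hne)
  have h0 : G p (a - b) (a - b) = 0 := by
    rw [(G p).map_sub, sub_apply, hab, sub_self]
  rw [h0] at this
  exact lt_irrefl _ this

theorem fderiv_symm (h : IsMetricOn G U) (hp : p ∈ U) (v a b : E) :
    fderiv ℝ G p v a b = fderiv ℝ G p v b a := by
  have hd := (h.differentiableAt hp).hasFDerivAt
  have h1 := (hd.clm_apply (hasFDerivAt_const a p)).clm_apply (hasFDerivAt_const b p)
  have h2 := (hd.clm_apply (hasFDerivAt_const b p)).clm_apply (hasFDerivAt_const a p)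
  have h3 := h1.congr_of_eventuallyEq (f₁ := fun q => G q b a)
    ((h.eventually_mem hp).mono fun q hq => h.symm q hq b a)
  exact (by simpa using congrArg (fun L => L v) (h3.unique h2))

variable [FiniteDimensional ℝ E]

theorem isInvertible (h : IsMetricOn G U) (hp : p ∈ U) : (G p).IsInvertible := by
  have hinj : Function.Injective (G p).toLinearMap := fun a b hab =>
    h.ext_inner hp fun c => congrArg (fun L : E →L[ℝ] ℝ => L c) hab
  have hfin : Module.finrank ℝ E = Module.finrank ℝ (E →L[ℝ] ℝ) := by
    rw [← LinearMap.toContinuousLinearMap.finrank_eq, Module.finrank_linearMap]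
    simp
  refine ⟨(LinearEquiv.ofInjectiveOfFinrankEq _ hinj hfin).toContinuousLinearEquiv, ?_⟩
  ext a b
  rfl

theorem inner_christoffel (h : IsMetricOn G U) (hp : p ∈ U) (a b c : E) :
    G p (christoffel G p a b) c =
      1 / 2 * (fderiv ℝ G p a b c + fderiv ℝ G p b a c - fderiv ℝ G p c a b) := by
  rw [← christoffelFirst_apply]
  change G p ((G p).inverse (christoffelFirst G p a b)) c = _
  rw [(h.isInvertible hp).self_apply_inverse]

theorem christoffel_symm (h : IsMetricOn G U) (hp : p ∈ U) (a b : E) :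
    christoffel G p a b = christoffel G p b a := by
  refine h.ext_inner hp fun c => ?_
  rw [h.inner_christoffel hp, h.inner_christoffel hp, h.fderiv_symm hp c a b]
  ring

theorem fderiv_eq_christoffel (h : IsMetricOn G U) (hp : p ∈ U) (a b c : E) :
    fderiv ℝ G p a b c = G p (christoffel G p a b) c + G p b (christoffel G p a c) := by
  rw [h.symm p hp b, h.inner_christoffel hp, h.inner_christoffel hp, h.fderiv_symm hp b a c,
    h.fderiv_symm hp a c b, h.fderiv_symm hp c a b]
  ring

/-- The Christoffel symbols are the only symmetric symbols compatible with the metric. -/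
theorem eq_christoffel (h : IsMetricOn G U) (hp : p ∈ U) {γ : E → E → E}
    (hsymm : ∀ a b, γ a b = γ b a)
    (hcompat : ∀ a b c, fderiv ℝ G p a b c = G p (γ a b) c + G p b (γ a c)) (a b : E) :
    γ a b = christoffel G p a b := by
  refine h.ext_inner hp fun c => ?_
  rw [h.inner_christoffel hp, hcompat, hcompat, hcompat, h.symm p hp b, h.symm p hp a,
    hsymm b a, hsymm c b, hsymm c a, h.symm p hp (γ b c)]
  ring

theorem differentiableAt_christoffel (h : IsMetricOn G U) (hp : p ∈ U) :
    DifferentiableAt ℝ (christoffel G) p := by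
  have h1 : DifferentiableAt ℝ (fderiv ℝ G) p :=
    ((h.contDiffAt hp).fderiv_right (m := 1) (by norm_cast)).differentiableAt one_ne_zero
  have h2 : DifferentiableAt ℝ (fun q => (G q).inverse) p :=
    ((h.isInvertible hp).contDiffAt_map_inverse (n := 1)).differentiableAt one_ne_zero
      |>.comp p (h.differentiableAt hp)
  have h3 : DifferentiableAt ℝ (fun q => (fderiv ℝ G q).flip) p :=
    (ContinuousLinearMap.flipₗᵢ ℝ E E (E →L[ℝ] ℝ)).differentiable.differentiableAt.comp p h1
  have h4 : DifferentiableAt ℝ (christoffelFirst G) p := by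
    refine ((h1.add h3).sub (DifferentiableAt.clm_comp (differentiableAt_const _) h3)).const_smul
      (1 / 2 : ℝ)
  exact ((ContinuousLinearMap.compL ℝ E (E →L[ℝ] ℝ) E).differentiableAt.comp p h2).clm_comp h4

/-- The curvature endomorphisms are skew-symmetric, because the second derivative of `G(c, d)` is
symmetric. -/
theorem inner_riemann_skew (h : IsMetricOn G U) (hp : p ∈ U) (a b c d : E) :
    G p (riemann (christoffel G) p a b c) d = - G p c (riemann (christoffel G) p a b d) := by
  have hΓ := (h.differentiableAt_christoffel hp).hasFDerivAt
  have hG := (h.differentiableAt hp).hasFDerivAt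
  have hDG : DifferentiableAt ℝ (fderiv ℝ G) p :=
    ((h.contDiffAt hp).fderiv_right (m := 1) (by norm_cast)).differentiableAt one_ne_zero
  have key : ∀ a b : E, fderiv ℝ (fderiv ℝ G) p b a c d =
      G p (christoffel G p b (christoffel G p a c)) d +
      G p (christoffel G p a c) (christoffel G p b d) +
      G p (fderiv ℝ (christoffel G) p b a c) d +
      (G p (christoffel G p b c) (christoffel G p a d) +
      G p c (christoffel G p b (christoffel G p a d)) +
      G p c (fderiv ℝ (christoffel G) p b a d)) := by
    intro a b
    have h1 := ((hDG.hasFDerivAt.clm_apply (hasFDerivAt_const a p)).clm_apply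
      (hasFDerivAt_const c p)).clm_apply (hasFDerivAt_const d p)
    have hΓc := (hΓ.clm_apply (hasFDerivAt_const a p)).clm_apply (hasFDerivAt_const c p)
    have hΓd := (hΓ.clm_apply (hasFDerivAt_const a p)).clm_apply (hasFDerivAt_const d p)
    have h2 := ((hG.clm_apply hΓc).clm_apply (hasFDerivAt_const d p)).add
      ((hG.clm_apply (hasFDerivAt_const c p)).clm_apply hΓd)
    have h3 := h1.congr_of_eventuallyEq
      (f₁ := fun q => G q (christoffel G q a c) d + G q c (christoffel G q a d))
      ((h.eventually_mem hp).mono fun q hq => (h.fderiv_eq_christoffel hq a c d).symm)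
    have h4 := congrArg (fun L => L b) (h3.unique h2)
    simp only [add_apply, ContinuousLinearMap.comp_apply, ContinuousLinearMap.flip_apply,
      map_zero, zero_apply, zero_add] at h4
    rw [h4, h.fderiv_eq_christoffel hp, h.fderiv_eq_christoffel hp]
    ring
  have hsymm : fderiv ℝ (fderiv ℝ G) p a b = fderiv ℝ (fderiv ℝ G) p b a :=
    ((h.contDiffAt hp).isSymmSndFDerivAt (by simpa using by norm_cast)).eq a b
  have h5 := key b a
  rw [hsymm, key a b] at h5
  simp only [riemann_apply, map_add, map_sub, add_apply, sub_apply]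
  linear_combination -h5

theorem fderiv_christoffel_symm (h : IsMetricOn G U) (hp : p ∈ U) (v a b : E) :
    fderiv ℝ (christoffel G) p v a b = fderiv ℝ (christoffel G) p v b a := by
  have hd := (h.differentiableAt_christoffel hp).hasFDerivAt
  have h1 := (hd.clm_apply (hasFDerivAt_const a p)).clm_apply (hasFDerivAt_const b p)
  have h2 := (hd.clm_apply (hasFDerivAt_const b p)).clm_apply (hasFDerivAt_const a p)
  have h3 := h1.congr_of_eventuallyEq (f₁ := fun q => christoffel G q b a)
    ((h.eventually_mem hp).mono fun q hq => h.christoffel_symm hq b a)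
  exact (by simpa using congrArg (fun L => L v) (h3.unique h2))

theorem riemann_bianchi (h : IsMetricOn G U) (hp : p ∈ U) (a b c : E) :
    riemann (christoffel G) p a b c + riemann (christoffel G) p b c a +
      riemann (christoffel G) p c a b = 0 := by
  simp only [riemann_apply]
  rw [h.fderiv_christoffel_symm hp a c b, h.fderiv_christoffel_symm hp b c a,
    h.fderiv_christoffel_symm hp c b a, h.christoffel_symm hp b c, h.christoffel_symm hp a c,
    h.christoffel_symm hp a b]
  abel

/-- The pair symmetry `g(R(a, b)c, d) = g(R(c, d)a, b)`. -/
theorem inner_riemann_pair_symm (h : IsMetricOn G U) (hp : p ∈ U) (a b c d : E) :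
    G p (riemann (christoffel G) p a b c) d = G p (riemann (christoffel G) p c d a) b := by
  have hB : ∀ a b c d, G p (riemann (christoffel G) p a b c) d +
      G p (riemann (christoffel G) p b c a) d + G p (riemann (christoffel G) p c a b) d = 0 := by
    intro a b c d
    rw [← add_apply, ← map_add, ← add_apply, ← map_add, h.riemann_bianchi hp]
    simp
  have hS : ∀ a b c d, G p (riemann (christoffel G) p a b c) d =
      - G p (riemann (christoffel G) p a b d) c := by
    intro a b c d
    rw [h.inner_riemann_skew hp, h.symm p hp]
  have hA : ∀ a b c d, G p (riemann (christoffel G) p a b c) d =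
      - G p (riemann (christoffel G) p b a c) d := by
    intro a b c d
    rw [← neg_apply, ← map_neg]
    congr 2
    simp only [riemann_apply]
    abel
  linarith [hB a b c d, hB b c d a, hB c d a b, hB d a b c, hS a b c d, hS b c a d, hS c a b d,
    hS b c d a, hS c d b a, hS d b c a, hS c d a b, hS d a c b, hS a c d b, hS d a b c,
    hS a b d c, hS b d a c, hA a b c d, hA b c a d, hA c a b d, hA c d a b, hA d b c a, hA d a c b,
    hA b d a c, hA a c d b]

end IsMetricOn

end Coordinates

/-! ### Horizontal and vertical fields in coordinates -/

section FrameCoordinates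

variable {n : ℕ} {E : Type*} [NormedAddCommGroup E] [NormedSpace ℝ E]

/-- The horizontal lift of the vector field `a` in the coordinates `(p, ψ)` of the frame bundle:
the frame vectors `ψ e_i` move by `-Γ_p(a, ψ e_i)`, i.e. by parallel transport. -/
def hRep (n : ℕ) (Γ : E → E →L[ℝ] E →L[ℝ] E) (a : E → E)
    (q : E × (EuclideanSpace ℝ (Fin n) →L[ℝ] E)) : E × (EuclideanSpace ℝ (Fin n) →L[ℝ] E) :=
  (a q.1, -(Γ q.1 (a q.1)).comp q.2)

/-- The `i`-th vertical lift of the vector field `b` in the coordinates `(p, ψ)` of the frame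
bundle: the frame vector `ψ e_i` moves by `b` and the other ones are fixed. -/
def vRep (i : Fin n) (b : E → E)
    (q : E × (EuclideanSpace ℝ (Fin n) →L[ℝ] E)) : E × (EuclideanSpace ℝ (Fin n) →L[ℝ] E) :=
  (0, (EuclideanSpace.proj i : EuclideanSpace ℝ (Fin n) →L[ℝ] ℝ).smulRight (b q.1))

variable {Γ : E → E →L[ℝ] E →L[ℝ] E} {a b : E → E}
  {q : E × (EuclideanSpace ℝ (Fin n) →L[ℝ] E)}

theorem hasFDerivAt_comp_fst {F : Type*} [NormedAddCommGroup F] [NormedSpace ℝ F] {f : E → F}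
    (hf : DifferentiableAt ℝ f q.1) :
    HasFDerivAt (fun r : E × (EuclideanSpace ℝ (Fin n) →L[ℝ] E) => f r.1)
      ((fderiv ℝ f q.1).comp (ContinuousLinearMap.fst ℝ E _)) q :=
  hf.hasFDerivAt.comp q hasFDerivAt_fst

theorem hasFDerivAt_hRep (hΓ : DifferentiableAt ℝ Γ q.1) (ha : DifferentiableAt ℝ a q.1) :
    ∃ L : (E × (EuclideanSpace ℝ (Fin n) →L[ℝ] E)) →L[ℝ] (E × (EuclideanSpace ℝ (Fin n) →L[ℝ] E)),
      HasFDerivAt (hRep n Γ a) L q ∧ ∀ w, L w = (fderiv ℝ a q.1 w.1,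
      -((fderiv ℝ Γ q.1 w.1 (a q.1) + Γ q.1 (fderiv ℝ a q.1 w.1)).comp q.2 +
        (Γ q.1 (a q.1)).comp w.2)) := by
  have h1 := hasFDerivAt_comp_fst (n := n) hΓ
  have h2 := hasFDerivAt_comp_fst (n := n) ha
  have h3 := ((h1.clm_apply h2).clm_comp
    (hasFDerivAt_snd (𝕜 := ℝ) (p := q))).neg
  refine ⟨_, h2.prodMk h3, fun w => ?_⟩
  refine Prod.ext rfl ?_
  ext x
  simp
  abel

theorem hasFDerivAt_vRep (i : Fin n) (hb : DifferentiableAt ℝ b q.1) :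
    ∃ L : (E × (EuclideanSpace ℝ (Fin n) →L[ℝ] E)) →L[ℝ] (E × (EuclideanSpace ℝ (Fin n) →L[ℝ] E)),
      HasFDerivAt (vRep i b) L q ∧ ∀ w, L w =
      (0, (EuclideanSpace.proj i : EuclideanSpace ℝ (Fin n) →L[ℝ] ℝ).smulRight
        (fderiv ℝ b q.1 w.1)) := by
  have h2 := hasFDerivAt_comp_fst (n := n) hb
  have h3 := (ContinuousLinearMap.smulRightL ℝ (EuclideanSpace ℝ (Fin n)) E
    (EuclideanSpace.proj i)).hasFDerivAt.comp q h2
  refine ⟨_, (hasFDerivAt_const (0 : E) q).prodMk h3, fun w => ?_⟩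
  refine Prod.ext rfl ?_
  ext x
  simp

theorem differentiableAt_hRep (hΓ : DifferentiableAt ℝ Γ q.1) (ha : DifferentiableAt ℝ a q.1) :
    DifferentiableAt ℝ (hRep n Γ a) q :=
  let ⟨_, h, _⟩ := hasFDerivAt_hRep hΓ ha
  h.differentiableAt

theorem differentiableAt_vRep (i : Fin n) (hb : DifferentiableAt ℝ b q.1) :
    DifferentiableAt ℝ (vRep i b) q :=
  let ⟨_, h, _⟩ := hasFDerivAt_vRep i hb
  h.differentiableAt

/-- The vertical part of the bracket of two horizontal lifts is the curvature. -/
theorem lieBracket_hRep_hRep (hΓ : DifferentiableAt ℝ Γ q.1) (ha : DifferentiableAt ℝ a q.1)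
    (hb : DifferentiableAt ℝ b q.1) :
    VectorField.lieBracket ℝ (hRep n Γ a) (hRep n Γ b) q =
      (VectorField.lieBracket ℝ a b q.1,
        -(Γ q.1 (VectorField.lieBracket ℝ a b q.1) + riemann Γ q.1 (a q.1) (b q.1)).comp q.2) := by
  obtain ⟨L, hL, hL'⟩ := hasFDerivAt_hRep hΓ ha
  obtain ⟨L₁, hL₁, hL₁'⟩ := hasFDerivAt_hRep hΓ hb
  rw [VectorField.lieBracket, hL.fderiv, hL₁.fderiv, hL', hL₁']
  refine Prod.ext rfl ?_
  ext1 x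
  simp [hRep, VectorField.lieBracket, riemann]
  abel

theorem lieBracket_hRep_vRep (i : Fin n) (hΓ : DifferentiableAt ℝ Γ q.1)
    (ha : DifferentiableAt ℝ a q.1) (hb : DifferentiableAt ℝ b q.1) :
    VectorField.lieBracket ℝ (hRep n Γ a) (vRep i b) q =
      (0, (EuclideanSpace.proj i : EuclideanSpace ℝ (Fin n) →L[ℝ] ℝ).smulRight
        (fderiv ℝ b q.1 (a q.1) + Γ q.1 (a q.1) (b q.1))) := by
  obtain ⟨L, hL, hL'⟩ := hasFDerivAt_hRep hΓ ha
  obtain ⟨L₁, hL₁, hL₁'⟩ := hasFDerivAt_vRep (q := q) i hb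
  rw [VectorField.lieBracket, hL.fderiv, hL₁.fderiv, hL', hL₁']
  refine Prod.ext (by simp [vRep]) ?_
  ext1 x
  simp [hRep, vRep]

theorem lieBracket_vRep_vRep (i j : Fin n) (ha : DifferentiableAt ℝ a q.1)
    (hb : DifferentiableAt ℝ b q.1) :
    VectorField.lieBracket ℝ (vRep i a) (vRep j b) q = 0 := by
  obtain ⟨L, hL, hL'⟩ := hasFDerivAt_vRep (q := q) i ha
  obtain ⟨L₁, hL₁, hL₁'⟩ := hasFDerivAt_vRep (q := q) j hb
  rw [VectorField.lieBracket, hL.fderiv, hL₁.fderiv, hL', hL₁']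
  refine Prod.ext (by simp) ?_
  ext1 x
  simp [vRep]

end FrameCoordinates

/-! ### Vector fields in charts -/

section Charts

variable {E : Type*} [NormedAddCommGroup E] [NormedSpace ℝ E]
    {H : Type*} [TopologicalSpace H] {I : ModelWithCorners ℝ E H}
    {N : Type*} [TopologicalSpace N] [ChartedSpace H N] [IsManifold I 1 N]

theorem eventuallyEq_mpullback_of_rep {x₀ y : N} (hy : y ∈ (chartAt H x₀).source)
    {V : ∀ x : N, TangentSpace I x} {V' : ∀ p : E, TangentSpace 𝓘(ℝ, E) p}
    (hV : ∀ᶠ z in 𝓝 y, mfderiv I 𝓘(ℝ, E) (extChartAt I x₀) z (V z) = V' (extChartAt I x₀ z)) :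
    V =ᶠ[𝓝 y] VectorField.mpullback I 𝓘(ℝ, E) (extChartAt I x₀) V' := by
  filter_upwards [hV, (chartAt H x₀).open_source.mem_nhds hy] with z hz hzs
  have := isInvertible_mfderiv_extChartAt (I := I) (x := x₀) (y := z) (by simpa using hzs)
  exact (this.inverse_apply_eq.2 hz.symm).symm

/-- A vector field with differentiable components in a chart is differentiable. -/
theorem mdifferentiableAt_of_rep [CompleteSpace E] [IsManifold I 2 N] {x₀ y : N}
    (hy : y ∈ (chartAt H x₀).source)
    {V : ∀ x : N, TangentSpace I x} {V' : ∀ p : E, TangentSpace 𝓘(ℝ, E) p}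
    (hV : ∀ᶠ z in 𝓝 y, mfderiv I 𝓘(ℝ, E) (extChartAt I x₀) z (V z) = V' (extChartAt I x₀ z))
    (hV' : DifferentiableAt ℝ (F := E) V' (extChartAt I x₀ y)) :
    MDifferentiableAt I I.tangent (fun z => (⟨z, V z⟩ : TangentBundle I N)) y := by
  have h0 : MDifferentiableAt 𝓘(ℝ, E) 𝓘(ℝ, E).tangent
      (fun z => (⟨z, V' z⟩ : TangentBundle 𝓘(ℝ, E) E)) (extChartAt I x₀ y) := by
    refine (mdifferentiableAt_section 𝓘(ℝ, E) V').2 ?_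
    simpa only [trivializationAt_model_space_apply] using hV'.mdifferentiableAt
  have h1 := h0.mpullback_vectorField (n := 2) (contMDiffAt_extChartAt' hy)
    (isInvertible_mfderiv_extChartAt (I := I) (x := x₀) (y := y) (by simpa using hy)) (by norm_num)
  refine h1.congr_of_eventuallyEq ?_
  filter_upwards [eventuallyEq_mpullback_of_rep hy hV] with z hz
  rw [hz]

/-- The components of a bracket in a chart are the bracket of the components. -/
theorem mfderiv_extChartAt_mlieBracket [CompleteSpace E] [IsManifold I 2 N] {x₀ y : N}
    (hy : y ∈ (chartAt H x₀).source)
    {V W : ∀ x : N, TangentSpace I x} {V' W' : ∀ p : E, TangentSpace 𝓘(ℝ, E) p}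
    (hV : ∀ᶠ z in 𝓝 y, mfderiv I 𝓘(ℝ, E) (extChartAt I x₀) z (V z) = V' (extChartAt I x₀ z))
    (hW : ∀ᶠ z in 𝓝 y, mfderiv I 𝓘(ℝ, E) (extChartAt I x₀) z (W z) = W' (extChartAt I x₀ z))
    (hV' : DifferentiableAt ℝ (F := E) V' (extChartAt I x₀ y))
    (hW' : DifferentiableAt ℝ (F := E) W' (extChartAt I x₀ y)) :
    mfderiv I 𝓘(ℝ, E) (extChartAt I x₀) y (VectorField.mlieBracket I V W y) =
      VectorField.lieBracket ℝ (E := E) V' W' (extChartAt I x₀ y) := by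
  have h0 : ∀ {V' : ∀ p : E, TangentSpace 𝓘(ℝ, E) p},
      DifferentiableAt ℝ (F := E) V' (extChartAt I x₀ y) →
      MDifferentiableAt 𝓘(ℝ, E) 𝓘(ℝ, E).tangent
      (fun z => (⟨z, V' z⟩ : TangentBundle 𝓘(ℝ, E) E)) (extChartAt I x₀ y) := by
    intro V' hV'
    refine (mdifferentiableAt_section 𝓘(ℝ, E) V').2 ?_
    simpa only [trivializationAt_model_space_apply] using hV'.mdifferentiableAt
  have : IsManifold I (minSmoothness ℝ 2) N := by simpa using ‹IsManifold I 2 N›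
  have hinv := isInvertible_mfderiv_extChartAt (I := I) (x := x₀) (y := y) (by simpa using hy)
  rw [(eventuallyEq_mpullback_of_rep hy hV).mlieBracket_vectorField_eq
    (eventuallyEq_mpullback_of_rep hy hW),
    ← VectorField.mpullback_mlieBracket (n := 2) (h0 hV') (h0 hW') (contMDiffAt_extChartAt' hy)
      (by simp), VectorField.mpullback_apply]
  have hb : VectorField.mlieBracket 𝓘(ℝ, E) V' W' = VectorField.lieBracket ℝ (E := E) V' W' :=
    (VectorField.mlieBracketWithin_eq_lieBracketWithin (s := Set.univ)).trans
      (VectorField.lieBracketWithin_univ ..)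
  rw [hinv.self_apply_inverse, hb]

theorem hasMFDerivAt_of_rep {F : Type*} [NormedAddCommGroup F] [NormedSpace ℝ F] {x₀ y : N}
    (hy : y ∈ (chartAt H x₀).source) {f : N → F} {f' : E → F}
    (hf : ∀ᶠ z in 𝓝 y, f z = f' (extChartAt I x₀ z))
    (hf' : DifferentiableAt ℝ f' (extChartAt I x₀ y)) :
    HasMFDerivAt I 𝓘(ℝ, F) f y ((fderiv ℝ f' (extChartAt I x₀ y)).comp
      (mfderiv I 𝓘(ℝ, E) (extChartAt I x₀) y)) := by
  have h1 : HasMFDerivAt I 𝓘(ℝ, E) (extChartAt I x₀) y (mfderiv I 𝓘(ℝ, E) (extChartAt I x₀) y) :=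
    (mdifferentiableAt_extChartAt hy).hasMFDerivAt
  exact (hf'.hasFDerivAt.hasMFDerivAt.comp y h1).congr_of_eventuallyEq hf

theorem mfderiv_of_rep {F : Type*} [NormedAddCommGroup F] [NormedSpace ℝ F] {x₀ y : N}
    (hy : y ∈ (chartAt H x₀).source) {f : N → F} {f' : E → F}
    (hf : ∀ᶠ z in 𝓝 y, f z = f' (extChartAt I x₀ z))
    (hf' : DifferentiableAt ℝ f' (extChartAt I x₀ y)) (v : TangentSpace I y) :
    (mfderiv I 𝓘(ℝ, F) f y v : F) =
      fderiv ℝ f' (extChartAt I x₀ y) (mfderiv I 𝓘(ℝ, E) (extChartAt I x₀) y v) := by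
  rw [(hasMFDerivAt_of_rep hy hf hf').mfderiv]
  rfl

end Charts

/-! ### The metric in a chart -/

section ChartConnection

variable {n : ℕ} {M : Type*} [TopologicalSpace M]
  [ChartedSpace (EuclideanSpace ℝ (Fin n)) M] [IsManifold (𝓡 n) ∞ M]

/-- The components of tangent vectors at `y` in the chart at `x₀`. -/
def coordL (x₀ y : M) : TangentSpace (𝓡 n) y →L[ℝ] EuclideanSpace ℝ (Fin n) :=
  (trivializationAt (EuclideanSpace ℝ (Fin n)) (TangentSpace (𝓡 n) : M → Type _)
    x₀).continuousLinearMapAt ℝ y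

/-- The vector field with constant components `a` in the chart at `x₀`. Only its
values in the chart domain matter. -/
def constField (x₀ : M) (a : EuclideanSpace ℝ (Fin n)) (y : M) : TangentSpace (𝓡 n) y :=
  (trivializationAt (EuclideanSpace ℝ (Fin n)) (TangentSpace (𝓡 n) : M → Type _) x₀).symm y a

theorem constField_eq_symmL {x₀ y : M}
    (hy : y ∈ (chartAt (EuclideanSpace ℝ (Fin n)) x₀).source) (a : EuclideanSpace ℝ (Fin n)) :
    constField x₀ a y = (trivializationAt (EuclideanSpace ℝ (Fin n))
      (TangentSpace (𝓡 n) : M → Type _) x₀).symmL ℝ y a :=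
  (Bundle.Trivialization.symmL_apply _ hy a).symm

theorem coordL_constField {x₀ y : M} (hy : y ∈ (chartAt (EuclideanSpace ℝ (Fin n)) x₀).source)
    (a : EuclideanSpace ℝ (Fin n)) : coordL x₀ y (constField x₀ a y) = a := by
  rw [constField_eq_symmL hy]
  exact (trivializationAt (EuclideanSpace ℝ (Fin n)) (TangentSpace (𝓡 n) : M → Type _)
    x₀).continuousLinearMapAt_symmL (R := ℝ) hy a

theorem constField_coordL {x₀ y : M} (hy : y ∈ (chartAt (EuclideanSpace ℝ (Fin n)) x₀).source)
    (v : TangentSpace (𝓡 n) y) : constField x₀ (coordL x₀ y v) y = v := by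
  rw [constField_eq_symmL hy]
  exact (trivializationAt (EuclideanSpace ℝ (Fin n)) (TangentSpace (𝓡 n) : M → Type _)
    x₀).symmL_continuousLinearMapAt (R := ℝ) hy v

theorem coordL_injective {x₀ y : M} (hy : y ∈ (chartAt (EuclideanSpace ℝ (Fin n)) x₀).source) :
    Function.Injective (coordL (n := n) x₀ y) :=
  Function.LeftInverse.injective (constField_coordL hy)

theorem coordL_eq_mfderiv {x₀ y : M}
    (hy : y ∈ (chartAt (EuclideanSpace ℝ (Fin n)) x₀).source) :
    coordL (n := n) x₀ y =
      mfderiv (𝓡 n) 𝓘(ℝ, EuclideanSpace ℝ (Fin n)) (extChartAt (𝓡 n) x₀) y :=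
  TangentBundle.continuousLinearMapAt_trivializationAt hy

theorem coordL_apply {x₀ y : M} (hy : y ∈ (chartAt (EuclideanSpace ℝ (Fin n)) x₀).source)
    (v : TangentSpace (𝓡 n) y) : coordL x₀ y v =
      (trivializationAt (EuclideanSpace ℝ (Fin n)) (TangentSpace (𝓡 n) : M → Type _) x₀
        ⟨y, v⟩).2 := by
  simp only [coordL]
  exact Bundle.Trivialization.continuousLinearMapAt_apply_of_mem ℝ _ hy _

theorem extend_eq_constField (x : M) (v : TangentSpace (𝓡 n) x) :
    (FiberBundle.extend (EuclideanSpace ℝ (Fin n)) v : ∀ y : M, TangentSpace (𝓡 n) y) =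
      constField x (coordL x x v) := by
  funext y
  rw [coordL_apply (mem_chart_source _ x)]
  rfl

theorem contMDiffOn_constField (x₀ : M) (a : EuclideanSpace ℝ (Fin n)) :
    ContMDiffOn (𝓡 n) (𝓡 n).tangent ∞ (fun y => (⟨y, constField x₀ a y⟩ : TangentBundle (𝓡 n) M))
      (chartAt (EuclideanSpace ℝ (Fin n)) x₀).source := by
  refine ((trivializationAt (EuclideanSpace ℝ (Fin n)) (TangentSpace (𝓡 n) : M → Type _)
    x₀).contMDiffOn_section_baseSet_iff (IB := 𝓡 n) (n := ∞)).2 ?_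
  refine (contMDiffOn_const (c := a)).congr fun y hy => ?_
  rw [← coordL_apply hy, coordL_constField hy]

omit [IsManifold (𝓡 n) ∞ M] in
theorem eventually_mem_source {x₀ y : M}
    (hy : y ∈ (chartAt (EuclideanSpace ℝ (Fin n)) x₀).source) :
    ∀ᶠ z in 𝓝 y, z ∈ (chartAt (EuclideanSpace ℝ (Fin n)) x₀).source :=
  (chartAt (EuclideanSpace ℝ (Fin n)) x₀).open_source.mem_nhds hy

theorem mdifferentiableAt_constField {x₀ y : M}
    (hy : y ∈ (chartAt (EuclideanSpace ℝ (Fin n)) x₀).source) (a : EuclideanSpace ℝ (Fin n)) :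
    MDifferentiableAt (𝓡 n) (𝓡 n).tangent
      (fun y => (⟨y, constField x₀ a y⟩ : TangentBundle (𝓡 n) M)) y :=
  ((contMDiffOn_constField x₀ a).contMDiffAt (eventually_mem_source hy)).mdifferentiableAt
    (by simp)

theorem eventually_mfderiv_eq_of_rep {x₀ y : M}
    (hy : y ∈ (chartAt (EuclideanSpace ℝ (Fin n)) x₀).source)
    {V : ∀ x : M, TangentSpace (𝓡 n) x}
    {V' : EuclideanSpace ℝ (Fin n) → EuclideanSpace ℝ (Fin n)}
    (hV : ∀ᶠ z in 𝓝 y, coordL x₀ z (V z) = V' (extChartAt (𝓡 n) x₀ z)) :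
    ∀ᶠ z in 𝓝 y, mfderiv (𝓡 n) 𝓘(ℝ, EuclideanSpace ℝ (Fin n)) (extChartAt (𝓡 n) x₀) z (V z) =
      V' (extChartAt (𝓡 n) x₀ z) := by
  filter_upwards [hV, eventually_mem_source hy] with z hz hzs
  rw [← hz, coordL_eq_mfderiv hzs]
  rfl

theorem mfderiv_eq_fderiv_coordL {F : Type*} [NormedAddCommGroup F] [NormedSpace ℝ F] {x₀ y : M}
    (hy : y ∈ (chartAt (EuclideanSpace ℝ (Fin n)) x₀).source) {f : M → F}
    {f' : EuclideanSpace ℝ (Fin n) → F}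
    (hf : ∀ᶠ z in 𝓝 y, f z = f' (extChartAt (𝓡 n) x₀ z))
    (hf' : DifferentiableAt ℝ f' (extChartAt (𝓡 n) x₀ y)) (v : TangentSpace (𝓡 n) y) :
    (mfderiv (𝓡 n) 𝓘(ℝ, F) f y v : F) =
      fderiv ℝ f' (extChartAt (𝓡 n) x₀ y) (coordL x₀ y v) := by
  rw [coordL_eq_mfderiv hy]
  exact mfderiv_of_rep hy hf hf' v

theorem mlieBracket_rep {x₀ y : M}
    (hy : y ∈ (chartAt (EuclideanSpace ℝ (Fin n)) x₀).source)
    {V W : ∀ x : M, TangentSpace (𝓡 n) x}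
    {V' W' : EuclideanSpace ℝ (Fin n) → EuclideanSpace ℝ (Fin n)}
    (hV : ∀ᶠ z in 𝓝 y, coordL x₀ z (V z) = V' (extChartAt (𝓡 n) x₀ z))
    (hW : ∀ᶠ z in 𝓝 y, coordL x₀ z (W z) = W' (extChartAt (𝓡 n) x₀ z))
    (hV' : DifferentiableAt ℝ V' (extChartAt (𝓡 n) x₀ y))
    (hW' : DifferentiableAt ℝ W' (extChartAt (𝓡 n) x₀ y)) :
    coordL x₀ y (VectorField.mlieBracket (𝓡 n) V W y) =
      VectorField.lieBracket ℝ V' W' (extChartAt (𝓡 n) x₀ y) := by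
  have : IsManifold (𝓡 n) 2 M := IsManifold.of_le (n := ∞) (by norm_cast)
  rw [coordL_eq_mfderiv hy]
  exact mfderiv_extChartAt_mlieBracket hy (eventually_mfderiv_eq_of_rep hy hV)
    (eventually_mfderiv_eq_of_rep hy hW) hV' hW'

theorem constField_rep {x₀ y : M} (hy : y ∈ (chartAt (EuclideanSpace ℝ (Fin n)) x₀).source)
    (a : EuclideanSpace ℝ (Fin n)) : ∀ᶠ z in 𝓝 y, coordL x₀ z (constField x₀ a z) =
      (fun _ => a) (extChartAt (𝓡 n) x₀ z) :=
  (eventually_mem_source hy).mono fun _ hz => coordL_constField hz a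

theorem mlieBracket_constField {x₀ y : M}
    (hy : y ∈ (chartAt (EuclideanSpace ℝ (Fin n)) x₀).source) (a b : EuclideanSpace ℝ (Fin n)) :
    VectorField.mlieBracket (𝓡 n) (constField x₀ a) (constField x₀ b) y = 0 := by
  apply coordL_injective hy
  rw [mlieBracket_rep hy (constField_rep hy a) (constField_rep hy b)
    (differentiableAt_const _) (differentiableAt_const _), map_zero]
  simp [VectorField.lieBracket]

variable (g : ContMDiffRiemannianMetric (𝓡 n) ∞ (EuclideanSpace ℝ (Fin n))
      (TangentSpace (𝓡 n) : M → Type _))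

/-- The components of the metric `g` in the chart at `x₀`. -/
def metricRep (x₀ : M) (p : EuclideanSpace ℝ (Fin n)) :
    EuclideanSpace ℝ (Fin n) →L[ℝ] EuclideanSpace ℝ (Fin n) →L[ℝ] ℝ :=
  let y := (extChartAt (𝓡 n) x₀).symm p
  let s := (trivializationAt (EuclideanSpace ℝ (Fin n)) (TangentSpace (𝓡 n) : M → Type _)
    x₀).symmL ℝ y
  (ContinuousLinearMap.precomp ℝ s).comp ((g.inner y).comp s)

omit [IsManifold (𝓡 n) ∞ M] in
theorem extChartAt_symm_mem_source {x₀ : M} {p : EuclideanSpace ℝ (Fin n)}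
    (hp : p ∈ (extChartAt (𝓡 n) x₀).target) :
    (extChartAt (𝓡 n) x₀).symm p ∈ (chartAt (EuclideanSpace ℝ (Fin n)) x₀).source := by
  simpa only [extChartAt_source] using (extChartAt (𝓡 n) x₀).map_target hp

theorem metricRep_apply {x₀ : M} {p : EuclideanSpace ℝ (Fin n)}
    (hp : p ∈ (extChartAt (𝓡 n) x₀).target) (a b : EuclideanSpace ℝ (Fin n)) :
    metricRep g x₀ p a b = g.inner ((extChartAt (𝓡 n) x₀).symm p)
      (constField x₀ a ((extChartAt (𝓡 n) x₀).symm p))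
      (constField x₀ b ((extChartAt (𝓡 n) x₀).symm p)) := by
  rw [constField_eq_symmL (extChartAt_symm_mem_source hp),
    constField_eq_symmL (extChartAt_symm_mem_source hp)]
  rfl

omit [IsManifold (𝓡 n) ∞ M] in
theorem extChartAt_mem_target {x₀ y : M}
    (hy : y ∈ (chartAt (EuclideanSpace ℝ (Fin n)) x₀).source) :
    extChartAt (𝓡 n) x₀ y ∈ (extChartAt (𝓡 n) x₀).target :=
  (extChartAt (𝓡 n) x₀).map_source (by rwa [extChartAt_source])

theorem metricRep_extChartAt {x₀ y : M}
    (hy : y ∈ (chartAt (EuclideanSpace ℝ (Fin n)) x₀).source) (a b : EuclideanSpace ℝ (Fin n)) :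
    metricRep g x₀ (extChartAt (𝓡 n) x₀ y) a b =
      g.inner y (constField x₀ a y) (constField x₀ b y) := by
  rw [metricRep_apply g (extChartAt_mem_target hy),
    (extChartAt (𝓡 n) x₀).left_inv (by rwa [extChartAt_source])]

theorem inner_eq_metricRep {x₀ y : M}
    (hy : y ∈ (chartAt (EuclideanSpace ℝ (Fin n)) x₀).source) (v w : TangentSpace (𝓡 n) y) :
    g.inner y v w = metricRep g x₀ (extChartAt (𝓡 n) x₀ y) (coordL x₀ y v) (coordL x₀ y w) := by
  rw [metricRep_extChartAt g hy, constField_coordL hy, constField_coordL hy]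

theorem contMDiffOn_inner_constField (x₀ : M) (a b : EuclideanSpace ℝ (Fin n)) :
    ContMDiffOn (𝓡 n) 𝓘(ℝ, ℝ) ∞
      (fun y => g.inner y (constField x₀ a y) (constField x₀ b y))
      (chartAt (EuclideanSpace ℝ (Fin n)) x₀).source := by
  have h := ContMDiffOn.clm_bundle_apply₂ (F₁ := EuclideanSpace ℝ (Fin n))
    (F₂ := EuclideanSpace ℝ (Fin n)) (F₃ := ℝ) (E₃ := Bundle.Trivial M ℝ)
    (g.contMDiff.contMDiffOn (s := (chartAt (EuclideanSpace ℝ (Fin n)) x₀).source))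
    (contMDiffOn_constField x₀ a) (contMDiffOn_constField x₀ b)
  intro y hy
  exact (contMDiffWithinAt_totalSpace.1 (h y hy)).2

theorem isMetricOn_metricRep (x₀ : M) :
    IsMetricOn (metricRep g x₀) (extChartAt (𝓡 n) x₀).target where
  isOpen := isOpen_extChartAt_target x₀
  contDiffOn := by
    refine contDiffOn_clm_apply.2 fun a => contDiffOn_clm_apply.2 fun b => ?_
    have h := (contMDiffOn_inner_constField g x₀ a b).comp (contMDiffOn_extChartAt_symm x₀)
      (fun p hp => extChartAt_symm_mem_source hp)
    exact h.contDiffOn.congr fun p hp => metricRep_apply g hp a b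
  symm p hp a b := by
    rw [metricRep_apply g hp, metricRep_apply g hp, g.symm]
  pos p hp a ha := by
    rw [metricRep_apply g hp]
    refine g.pos _ _ fun h0 => ha ?_
    rw [← coordL_constField (extChartAt_symm_mem_source hp) a, h0, map_zero]

/-- The Christoffel symbols of the metric `g` in the chart at `x₀`. -/
def chartChristoffel (x₀ : M) (p : EuclideanSpace ℝ (Fin n)) :
    EuclideanSpace ℝ (Fin n) →L[ℝ] EuclideanSpace ℝ (Fin n) →L[ℝ] EuclideanSpace ℝ (Fin n) :=
  christoffel (metricRep g x₀) p

theorem mfderiv_inner_of_rep {x₀ y : M}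
    (hy : y ∈ (chartAt (EuclideanSpace ℝ (Fin n)) x₀).source)
    {V W : ∀ x : M, TangentSpace (𝓡 n) x}
    {V' W' : EuclideanSpace ℝ (Fin n) → EuclideanSpace ℝ (Fin n)}
    (hV : ∀ᶠ z in 𝓝 y, coordL x₀ z (V z) = V' (extChartAt (𝓡 n) x₀ z))
    (hW : ∀ᶠ z in 𝓝 y, coordL x₀ z (W z) = W' (extChartAt (𝓡 n) x₀ z))
    (hV' : DifferentiableAt ℝ V' (extChartAt (𝓡 n) x₀ y))
    (hW' : DifferentiableAt ℝ W' (extChartAt (𝓡 n) x₀ y)) (v : TangentSpace (𝓡 n) y) :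
    (mfderiv (𝓡 n) 𝓘(ℝ, ℝ) (fun z => g.inner z (V z) (W z)) y v : ℝ) =
      let p := extChartAt (𝓡 n) x₀ y
      let G := metricRep g x₀
      fderiv ℝ G p (coordL x₀ y v) (V' p) (W' p) +
        G p (fderiv ℝ V' p (coordL x₀ y v)) (W' p) +
        G p (V' p) (fderiv ℝ W' p (coordL x₀ y v)) := by
  have hG := (isMetricOn_metricRep g x₀).differentiableAt (extChartAt_mem_target hy)
  have hd := (hG.hasFDerivAt.clm_apply hV'.hasFDerivAt).clm_apply hW'.hasFDerivAt
  have h1 : ∀ᶠ z in 𝓝 y, g.inner z (V z) (W z) =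
      (fun p => metricRep g x₀ p (V' p) (W' p)) (extChartAt (𝓡 n) x₀ z) := by
    filter_upwards [hV, hW, eventually_mem_source hy] with z h2 h3 hz
    rw [inner_eq_metricRep g hz, h2, h3]
  rw [mfderiv_eq_fderiv_coordL hy h1 hd.differentiableAt, fderiv_bilin_apply hG hV' hW']

end ChartConnection

/-! ### The covariant derivative and the curvature in a chart -/

section ChartConnection

variable {n : ℕ} {M : Type*} [TopologicalSpace M]
  [ChartedSpace (EuclideanSpace ℝ (Fin n)) M] [IsManifold (𝓡 n) ∞ M]

variable {g : ContMDiffRiemannianMetric (𝓡 n) ∞ (EuclideanSpace ℝ (Fin n))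
      (TangentSpace (𝓡 n) : M → Type _)}
    {cov : CovariantDerivative (𝓡 n) (EuclideanSpace ℝ (Fin n))
      (TangentSpace (𝓡 n) : M → Type _)}

/-- Off the centre of the chart too, a Levi-Civita connection has the Christoffel symbols of the
metric; this is where its smoothness comes from. -/
theorem coordL_cov_constField (hcov : IsLeviCivita (fun x v w => g.inner x v w) cov) {x₀ y : M}
    (hy : y ∈ (chartAt (EuclideanSpace ℝ (Fin n)) x₀).source) (b : EuclideanSpace ℝ (Fin n))
    (v : TangentSpace (𝓡 n) y) :
    coordL x₀ y (cov (constField x₀ b) y v) =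
      chartChristoffel g x₀ (extChartAt (𝓡 n) x₀ y) (coordL x₀ y v) b := by
  have hm := isMetricOn_metricRep g x₀
  have hp := extChartAt_mem_target hy
  have hsymm : ∀ a b : EuclideanSpace ℝ (Fin n),
      coordL x₀ y (cov (constField x₀ b) y (constField x₀ a y)) =
        coordL x₀ y (cov (constField x₀ a) y (constField x₀ b y)) := by
    intro a b
    have h := hcov.torsion_free (constField x₀ a) (constField x₀ b) y
      (mdifferentiableAt_constField hy a) (mdifferentiableAt_constField hy b)
    rw [mlieBracket_constField hy, sub_eq_zero] at h
    rw [h]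
  have hcompat : ∀ a b c : EuclideanSpace ℝ (Fin n),
      fderiv ℝ (metricRep g x₀) (extChartAt (𝓡 n) x₀ y) a b c =
        metricRep g x₀ (extChartAt (𝓡 n) x₀ y)
          (coordL x₀ y (cov (constField x₀ b) y (constField x₀ a y))) c +
        metricRep g x₀ (extChartAt (𝓡 n) x₀ y) b
          (coordL x₀ y (cov (constField x₀ c) y (constField x₀ a y))) := by
    intro a b c
    have h := hcov.metric (constField x₀ b) (constField x₀ c) y (constField x₀ a y)
      (mdifferentiableAt_constField hy b) (mdifferentiableAt_constField hy c)
    have h1 := mfderiv_inner_of_rep g hy (constField_rep hy b) (constField_rep hy c)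
      (differentiableAt_const _) (differentiableAt_const _) (constField x₀ a y)
    simp only [fderiv_fun_const, Pi.zero_apply, zero_apply, map_zero, add_zero,
      coordL_constField hy] at h1
    rw [← h1, h, inner_eq_metricRep g hy, inner_eq_metricRep g hy, coordL_constField hy,
      coordL_constField hy]
  have h := hm.eq_christoffel hp hsymm hcompat (coordL x₀ y v) b
  rwa [constField_coordL hy] at h

/-- The covariant derivative of a vector field in terms of its components. Compatibility with the
metric, tested against fields with constant components, is enough to see this. -/
theorem coordL_cov_of_rep (hcov : IsLeviCivita (fun x v w => g.inner x v w) cov) {x₀ y : M}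
    (hy : y ∈ (chartAt (EuclideanSpace ℝ (Fin n)) x₀).source)
    {Y : ∀ x : M, TangentSpace (𝓡 n) x}
    {Y' : EuclideanSpace ℝ (Fin n) → EuclideanSpace ℝ (Fin n)}
    (hY : ∀ᶠ z in 𝓝 y, coordL x₀ z (Y z) = Y' (extChartAt (𝓡 n) x₀ z))
    (hY' : DifferentiableAt ℝ Y' (extChartAt (𝓡 n) x₀ y)) (v : TangentSpace (𝓡 n) y) :
    coordL x₀ y (cov Y y v) = fderiv ℝ Y' (extChartAt (𝓡 n) x₀ y) (coordL x₀ y v) +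
      chartChristoffel g x₀ (extChartAt (𝓡 n) x₀ y) (coordL x₀ y v)
        (Y' (extChartAt (𝓡 n) x₀ y)) := by
  have hm := isMetricOn_metricRep g x₀
  have hp := extChartAt_mem_target hy
  have : IsManifold (𝓡 n) 2 M := IsManifold.of_le (n := ∞) (by norm_cast)
  have hYd : MDifferentiableAt (𝓡 n) (𝓡 n).tangent
      (fun z => (⟨z, Y z⟩ : TangentBundle (𝓡 n) M)) y :=
    mdifferentiableAt_of_rep hy (eventually_mfderiv_eq_of_rep hy hY) hY'
  refine hm.ext_inner hp fun c => ?_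
  have h := hcov.metric Y (constField x₀ c) y v hYd (mdifferentiableAt_constField hy c)
  have h1 := mfderiv_inner_of_rep g hy hY (constField_rep hy c) hY' (differentiableAt_const _) v
  simp only [fderiv_fun_const, Pi.zero_apply, zero_apply, map_zero, add_zero] at h1
  replace h := @Eq.trans ℝ _ _ _ (@Eq.symm ℝ _ _ h1) h
  rw [inner_eq_metricRep g hy, inner_eq_metricRep g hy, coordL_constField hy,
    coordL_cov_constField hcov hy, hY.self_of_nhds, hm.fderiv_eq_christoffel hp] at h
  rw [map_add, add_apply]
  unfold chartChristoffel at h ⊢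
  linear_combination -h

/-- The curvature in the chart at `x`. -/
theorem coordL_curvatureAt (hcov : IsLeviCivita (fun x v w => g.inner x v w) cov) (x : M)
    (v w z : TangentSpace (𝓡 n) x) :
    coordL x x (curvatureAt cov x v w z) =
      riemann (chartChristoffel g x) (extChartAt (𝓡 n) x x) (coordL x x v) (coordL x x w)
        (coordL x x z) := by
  have hx := mem_chart_source (EuclideanSpace ℝ (Fin n)) x
  have hΓ : DifferentiableAt ℝ (chartChristoffel g x) (extChartAt (𝓡 n) x x) :=
    (isMetricOn_metricRep g x).differentiableAt_christoffel (extChartAt_mem_target hx)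
  have key : ∀ a b c : EuclideanSpace ℝ (Fin n), coordL x x
      (cov (fun y => cov (constField x c) y (constField x b y)) x (constField x a x)) =
      fderiv ℝ (chartChristoffel g x) (extChartAt (𝓡 n) x x) a b c +
        chartChristoffel g x (extChartAt (𝓡 n) x x) a
          (chartChristoffel g x (extChartAt (𝓡 n) x x) b c) := by
    intro a b c
    have h1 : ∀ᶠ y in 𝓝 x, coordL x y (cov (constField x c) y (constField x b y)) =
        (fun p => chartChristoffel g x p b c) (extChartAt (𝓡 n) x y) := by
      filter_upwards [eventually_mem_source hx] with y hy
      rw [coordL_cov_constField hcov hy, coordL_constField hy]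
    have h2 := (hΓ.hasFDerivAt.clm_apply (hasFDerivAt_const b _)).clm_apply
      (hasFDerivAt_const c _)
    rw [coordL_cov_of_rep hcov hx h1 h2.differentiableAt, h2.fderiv, coordL_constField hx]
    simp
  have h := key (coordL x x v) (coordL x x w) (coordL x x z)
  have h' := key (coordL x x w) (coordL x x v) (coordL x x z)
  rw [constField_coordL hx] at h h'
  simp only [curvatureAt, extend_eq_constField]
  rw [mlieBracket_constField hx, map_zero, sub_zero, map_sub, h, h', riemann_apply]
  abel

end ChartConnection

/-! ### The connection map in a chart -/

section ConnectionMap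

variable {n : ℕ} {M : Type*} [TopologicalSpace M]
  [ChartedSpace (EuclideanSpace ℝ (Fin n)) M] [IsManifold (𝓡 n) ∞ M]

/-- A differentiable function on `M` is differentiable in every chart. -/
theorem exists_rep {F : Type*} [NormedAddCommGroup F] [NormedSpace ℝ F] {x₀ y : M}
    (hy : y ∈ (chartAt (EuclideanSpace ℝ (Fin n)) x₀).source) {f : M → F}
    (hf : MDifferentiableAt (𝓡 n) 𝓘(ℝ, F) f y) :
    ∃ f' : EuclideanSpace ℝ (Fin n) → F, DifferentiableAt ℝ f' (extChartAt (𝓡 n) x₀ y) ∧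
      ∀ᶠ z in 𝓝 y, f z = f' (extChartAt (𝓡 n) x₀ z) := by
  have hp := extChartAt_mem_target hy
  have hinv : ∀ z ∈ (chartAt (EuclideanSpace ℝ (Fin n)) x₀).source,
      (extChartAt (𝓡 n) x₀).symm (extChartAt (𝓡 n) x₀ z) = z :=
    fun z hz => (extChartAt (𝓡 n) x₀).left_inv (by rwa [extChartAt_source])
  refine ⟨f ∘ (extChartAt (𝓡 n) x₀).symm, ?_, ?_⟩
  · have h1 : MDifferentiableAt 𝓘(ℝ, EuclideanSpace ℝ (Fin n)) (𝓡 n)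
        (extChartAt (𝓡 n) x₀).symm (extChartAt (𝓡 n) x₀ y) :=
      ((contMDiffOn_extChartAt_symm (n := ∞) x₀).contMDiffAt
        ((isOpen_extChartAt_target x₀).mem_nhds hp)).mdifferentiableAt (by simp)
    have h2 : MDifferentiableAt (𝓡 n) 𝓘(ℝ, F) f
        ((extChartAt (𝓡 n) x₀).symm (extChartAt (𝓡 n) x₀ y)) := by rwa [hinv y hy]
    exact (h2.comp _ h1).differentiableAt
  · filter_upwards [eventually_mem_source hy] with z hz
    rw [Function.comp_apply, hinv z hz]

theorem exists_rep_field {x : M} {X : ∀ x : M, TangentSpace (𝓡 n) x}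
    (hX : MDifferentiableAt (𝓡 n) (𝓡 n).tangent
      (fun y => (⟨y, X y⟩ : TangentBundle (𝓡 n) M)) x) :
    ∃ X' : EuclideanSpace ℝ (Fin n) → EuclideanSpace ℝ (Fin n),
      DifferentiableAt ℝ X' (extChartAt (𝓡 n) x x) ∧
      ∀ᶠ z in 𝓝 x, coordL x z (X z) = X' (extChartAt (𝓡 n) x z) := by
  have hx := mem_chart_source (EuclideanSpace ℝ (Fin n)) x
  obtain ⟨X', hX', h⟩ := exists_rep hx ((mdifferentiableAt_section (𝓡 n) X).1 hX)
  refine ⟨X', hX', ?_⟩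
  filter_upwards [h, eventually_mem_source hx] with z hz hzs
  rw [← hz, coordL_apply hzs]

variable {g : ContMDiffRiemannianMetric (𝓡 n) ∞ (EuclideanSpace ℝ (Fin n))
      (TangentSpace (𝓡 n) : M → Type _)}
    {cov : CovariantDerivative (𝓡 n) (EuclideanSpace ℝ (Fin n))
      (TangentSpace (𝓡 n) : M → Type _)}

variable (n M) in
/-- The fibre component of tangent vectors in the chart at `x₀`. -/
def fiberCoord (x₀ : M) (η : TangentBundle (𝓡 n) M) : EuclideanSpace ℝ (Fin n) :=
  (trivializationAt (EuclideanSpace ℝ (Fin n)) (TangentSpace (𝓡 n) : M → Type _) x₀ η).2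

theorem fiberCoord_eq_coordL {x₀ : M} {η : TangentBundle (𝓡 n) M}
    (h : η.1 ∈ (chartAt (EuclideanSpace ℝ (Fin n)) x₀).source) :
    fiberCoord n M x₀ η = coordL x₀ η.1 η.2 := (coordL_apply h η.2).symm

theorem mdifferentiableAt_fiberCoord {x₀ : M} {ζ : TangentBundle (𝓡 n) M}
    (h : ζ.1 ∈ (chartAt (EuclideanSpace ℝ (Fin n)) x₀).source) :
    MDifferentiableAt (𝓡 n).tangent 𝓘(ℝ, EuclideanSpace ℝ (Fin n)) (fiberCoord n M x₀) ζ := by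
  have h0 : ContMDiffAt (𝓡 n).tangent (𝓡 n).tangent ∞ (id : TangentBundle (𝓡 n) M → _) ζ :=
    contMDiffAt_id
  have h1 := (((trivializationAt (EuclideanSpace ℝ (Fin n)) (TangentSpace (𝓡 n) : M → Type _)
    x₀).contMDiffAt_iff (IB := 𝓡 n) (IM := (𝓡 n).tangent) (n := ∞)
      (f := (id : TangentBundle (𝓡 n) M → _)) (x₀ := ζ) h).1 h0).2
  exact h1.mdifferentiableAt (by simp)

/-- Although `connectionMap` is defined by the chart at the base point, it has the same expression
in every chart. -/
theorem coordL_connectionMap (hcov : IsLeviCivita (fun x v w => g.inner x v w) cov) {x₀ : M}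
    (ζ : TangentBundle (𝓡 n) M)
    (hζ : ζ.1 ∈ (chartAt (EuclideanSpace ℝ (Fin n)) x₀).source)
    (A : TangentSpace (𝓡 n).tangent ζ) :
    coordL x₀ ζ.1 (connectionMap cov ζ A) =
      mvfderiv (𝓡 n).tangent (fiberCoord n M x₀) ζ A +
      chartChristoffel g x₀ (extChartAt (𝓡 n) x₀ ζ.1)
        (coordL x₀ ζ.1 (mfderiv (𝓡 n).tangent (𝓡 n)
          (fun η : TangentBundle (𝓡 n) M => η.1) ζ A)) (coordL x₀ ζ.1 ζ.2) := by
  set y := ζ.1 with hy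
  have hyy := mem_chart_source (EuclideanSpace ℝ (Fin n)) y
  set e := trivializationAt (EuclideanSpace ℝ (Fin n)) (TangentSpace (𝓡 n) : M → Type _) y with he
  set e₀ := trivializationAt (EuclideanSpace ℝ (Fin n)) (TangentSpace (𝓡 n) : M → Type _) x₀
    with he₀
  -- the transition function from the chart at `y` to the chart at `x₀`
  let C : M → EuclideanSpace ℝ (Fin n) →L[ℝ] EuclideanSpace ℝ (Fin n) :=
    fun z => (e.coordChangeL ℝ e₀ z : EuclideanSpace ℝ (Fin n) →L[ℝ] EuclideanSpace ℝ (Fin n))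
  have hC : MDifferentiableAt (𝓡 n)
      𝓘(ℝ, EuclideanSpace ℝ (Fin n) →L[ℝ] EuclideanSpace ℝ (Fin n)) C y :=
    mdifferentiableAt_coordChangeL hyy hζ
  have hCapp : ∀ z ∈ (chartAt (EuclideanSpace ℝ (Fin n)) y).source,
      z ∈ (chartAt (EuclideanSpace ℝ (Fin n)) x₀).source → ∀ b, C z b =
        coordL x₀ z (constField y b z) := by
    intro z hz hz₀ b
    rw [coordL_apply hz₀]
    exact e.coordChangeL_apply e₀ ⟨hz, hz₀⟩ b
  have hp : MDifferentiableAt (𝓡 n).tangent (𝓡 n)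
      (fun η : TangentBundle (𝓡 n) M => η.1) ζ :=
    mdifferentiableAt_proj (TangentSpace (𝓡 n) : M → Type _)
  set v : TangentSpace (𝓡 n) y := mfderiv (𝓡 n).tangent (𝓡 n)
    (fun η : TangentBundle (𝓡 n) M => η.1) ζ A with hv
  set z₁ : EuclideanSpace ℝ (Fin n) := coordL y y ζ.2 with hz₁
  let dC : TangentSpace (𝓡 n) y →L[ℝ]
      (EuclideanSpace ℝ (Fin n) →L[ℝ] EuclideanSpace ℝ (Fin n)) :=
    mfderiv (𝓡 n) 𝓘(ℝ, EuclideanSpace ℝ (Fin n) →L[ℝ] EuclideanSpace ℝ (Fin n)) C y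
  let dE : TangentSpace (𝓡 n).tangent ζ →L[ℝ] EuclideanSpace ℝ (Fin n) :=
    mfderiv (𝓡 n).tangent 𝓘(ℝ, EuclideanSpace ℝ (Fin n)) (fiberCoord n M y) ζ
  have hev : ∀ᶠ z in 𝓝 y, z ∈ (chartAt (EuclideanSpace ℝ (Fin n)) y).source ∧
      z ∈ (chartAt (EuclideanSpace ℝ (Fin n)) x₀).source :=
    (eventually_mem_source hyy).and (eventually_mem_source hζ)
  -- the fibre components in the chart at `x₀`
  have h1 : mvfderiv (𝓡 n).tangent (fiberCoord n M x₀) ζ A = dC v z₁ + C y (dE A) := by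
    have hd : HasMFDerivAt (𝓡 n).tangent
        𝓘(ℝ, EuclideanSpace ℝ (Fin n) →L[ℝ] EuclideanSpace ℝ (Fin n))
        (fun η : TangentBundle (𝓡 n) M => C η.1) ζ (dC.comp (mfderiv (𝓡 n).tangent (𝓡 n)
          (fun η : TangentBundle (𝓡 n) M => η.1) ζ)) :=
      HasMFDerivAt.comp (g := C) ζ hC.hasMFDerivAt hp.hasMFDerivAt
    have hE : HasMFDerivAt (𝓡 n).tangent 𝓘(ℝ, EuclideanSpace ℝ (Fin n)) (fiberCoord n M y) ζ dE :=
      (mdifferentiableAt_fiberCoord hyy).hasMFDerivAt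
    have hpr := hd.prodMk hE
    rw [← modelWithCornersSelf_prod] at hpr
    have hb := ((isBoundedBilinearMap_apply (𝕜 := ℝ) (E := EuclideanSpace ℝ (Fin n))
      (F := EuclideanSpace ℝ (Fin n))).hasFDerivAt (C ζ.1, fiberCoord n M y ζ)).hasMFDerivAt
    have hcomp := HasMFDerivAt.comp (f := fun η : TangentBundle (𝓡 n) M =>
      (C η.1, fiberCoord n M y η)) ζ hb hpr
    have heq : fiberCoord n M x₀ =ᶠ[𝓝 ζ] fun η => C η.1 (fiberCoord n M y η) := by
      have hc : ContinuousAt (fun η : TangentBundle (𝓡 n) M => η.1) ζ :=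
        (FiberBundle.continuous_proj _ _).continuousAt
      filter_upwards [hc.eventually hev] with η hη
      rw [hCapp _ hη.1 hη.2, fiberCoord_eq_coordL hη.1, fiberCoord_eq_coordL hη.2,
        constField_coordL hη.1]
    rw [mvfderiv, (hcomp.congr_of_eventuallyEq heq).mfderiv]
    have hz : fiberCoord n M y ζ = z₁ := fiberCoord_eq_coordL hyy
    change C y (dE A) + dC v (fiberCoord n M y ζ) = _
    rw [hz, add_comm]
  -- the components of the extension of `ζ`
  have h2 : coordL x₀ y (cov (FiberBundle.extend (EuclideanSpace ℝ (Fin n)) ζ.2) y v) =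
      dC v z₁ + chartChristoffel g x₀ (extChartAt (𝓡 n) x₀ y) (coordL x₀ y v)
        (coordL x₀ y ζ.2) := by
    have hCz : HasMFDerivAt (𝓡 n) 𝓘(ℝ, EuclideanSpace ℝ (Fin n)) (fun z => C z z₁) y
        ((ContinuousLinearMap.apply ℝ (EuclideanSpace ℝ (Fin n)) z₁).comp dC) :=
      HasMFDerivAt.comp
        (I' := 𝓘(ℝ, EuclideanSpace ℝ (Fin n) →L[ℝ] EuclideanSpace ℝ (Fin n))) y
        (ContinuousLinearMap.apply ℝ (EuclideanSpace ℝ (Fin n)) z₁).hasMFDerivAt hC.hasMFDerivAt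
    obtain ⟨f', hf', hf⟩ := exists_rep hζ hCz.mdifferentiableAt
    have hrep : ∀ᶠ z in 𝓝 y, coordL x₀ z (constField y z₁ z) = f' (extChartAt (𝓡 n) x₀ z) := by
      filter_upwards [hf, hev] with z hz hzs
      rw [← hz, hCapp z hzs.1 hzs.2]
    have h3 := mfderiv_eq_fderiv_coordL hζ hf hf' v
    rw [hCz.mfderiv] at h3
    rw [extend_eq_constField, coordL_cov_of_rep hcov hζ hrep hf', ← h3, ← hf.self_of_nhds,
      hCapp y hyy hζ, constField_coordL hyy]
    rfl
  rw [h1]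
  change coordL x₀ y (e.symmL ℝ y (dE A) +
    cov (FiberBundle.extend (EuclideanSpace ℝ (Fin n)) ζ.2) y v) = _
  rw [map_add, h2, ← constField_eq_symmL hyy, ← hCapp y hyy hζ]
  abel

end ConnectionMap

/-! ### The frame bundle in a chart -/

namespace FrameBundle

variable {n : ℕ} {M : Type*} [TopologicalSpace M]
  [ChartedSpace (EuclideanSpace ℝ (Fin n)) M] [IsManifold (𝓡 n) ∞ M]

/-- The components of the frame `w` in the chart at `x₀`. -/
def frameCoord (x₀ : M) (w : FrameBundle n M) :
    EuclideanSpace ℝ (Fin n) →L[ℝ] EuclideanSpace ℝ (Fin n) :=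
  (trivializationAt (EuclideanSpace ℝ (Fin n) →L[ℝ] EuclideanSpace ℝ (Fin n))
    (FrameHomFiber n M) x₀ w.1).2

theorem mem_hom_source {x₀ : M} {w : FrameBundle n M}
    (h : w.proj ∈ (chartAt (EuclideanSpace ℝ (Fin n)) x₀).source) :
    w.1 ∈ (trivializationAt (EuclideanSpace ℝ (Fin n) →L[ℝ] EuclideanSpace ℝ (Fin n))
      (FrameHomFiber n M) x₀).source := by
  rw [Bundle.Trivialization.mem_source]
  exact ⟨trivial, h⟩

theorem frameCoord_single {x₀ : M} {w : FrameBundle n M}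
    (h : w.proj ∈ (chartAt (EuclideanSpace ℝ (Fin n)) x₀).source) (i : Fin n) :
    frameCoord x₀ w (EuclideanSpace.single i 1) = coordL x₀ w.proj (w.vec i) := by
  have h1 : w.1.1 ∈ (trivializationAt (EuclideanSpace ℝ (Fin n))
    (Bundle.Trivial M (EuclideanSpace ℝ (Fin n))) x₀).baseSet := trivial
  have h2 : w.1.1 ∈ (trivializationAt (EuclideanSpace ℝ (Fin n))
    (TangentSpace (𝓡 n) : M → Type _) x₀).baseSet := h
  change (ContinuousLinearMap.inCoordinates _ _ _ _ x₀ w.1.1 x₀ w.1.1 w.1.2) _ = _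
  rw [ContinuousLinearMap.inCoordinates_eq h1 h2, coordL_apply h]
  simp [vec, proj]

theorem contMDiff_proj : ContMDiff (frameI n) (𝓡 n) ∞ (proj : FrameBundle n M → M) :=
  (Bundle.contMDiff_proj (FrameHomFiber n M)).comp contMDiff_subtype_val

theorem mdifferentiableAt_proj (w : FrameBundle n M) :
    MDifferentiableAt (frameI n) (𝓡 n) (proj : FrameBundle n M → M) w :=
  contMDiff_proj.contMDiffAt.mdifferentiableAt (by simp)

theorem mdifferentiableAt_toTangent (i : Fin n) (w : FrameBundle n M) :
    MDifferentiableAt (frameI n) (𝓡 n).tangent (toTangent i) w :=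
  (contMDiff_toTangent i).contMDiffAt.mdifferentiableAt (by simp)

theorem mdifferentiableAt_frameCoord {x₀ : M} {w : FrameBundle n M}
    (h : w.proj ∈ (chartAt (EuclideanSpace ℝ (Fin n)) x₀).source) :
    MDifferentiableAt (frameI n)
      𝓘(ℝ, EuclideanSpace ℝ (Fin n) →L[ℝ] EuclideanSpace ℝ (Fin n)) (frameCoord x₀) w := by
  have h0 : ContMDiffAt (frameI n) (frameI n) ∞ (Subtype.val : FrameBundle n M → _) w :=
    contMDiff_subtype_val w
  have h1 := ((trivializationAt (EuclideanSpace ℝ (Fin n) →L[ℝ] EuclideanSpace ℝ (Fin n))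
    (FrameHomFiber n M) x₀).contMDiffAt_iff (IB := 𝓡 n) (IM := frameI n) (n := ∞)
      (f := (Subtype.val : FrameBundle n M → _)) (mem_hom_source h)).1 h0
  exact h1.2.mdifferentiableAt (by simp)

theorem eventually_proj_mem {x₀ : M} {w : FrameBundle n M}
    (h : w.proj ∈ (chartAt (EuclideanSpace ℝ (Fin n)) x₀).source) :
    ∀ᶠ w' : FrameBundle n M in 𝓝 w,
      w'.proj ∈ (chartAt (EuclideanSpace ℝ (Fin n)) x₀).source :=
  (mdifferentiableAt_proj w).continuousAt.eventually (eventually_mem_source h)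

theorem extChartAt_eq {u w : FrameBundle n M}
    (h : w.proj ∈ (chartAt (EuclideanSpace ℝ (Fin n)) u.proj).source) :
    extChartAt (frameI n) u w = (extChartAt (𝓡 n) u.proj w.proj, frameCoord u.proj w) := by
  have h9 : extChartAt (frameI n) u w = extChartAt (frameI n) u.1 w.1 := rfl
  rw [h9, FiberBundle.extChartAt]
  have h10 := (trivializationAt (EuclideanSpace ℝ (Fin n) →L[ℝ] EuclideanSpace ℝ (Fin n))
    (FrameHomFiber n M) u.proj).coe_fst (mem_hom_source h)
  change (extChartAt (𝓡 n) u.proj (trivializationAt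
    (EuclideanSpace ℝ (Fin n) →L[ℝ] EuclideanSpace ℝ (Fin n))
    (FrameHomFiber n M) u.proj w.1).1, _) = _
  rw [h10]
  rfl

/-- The components of tangent vectors of the frame bundle in the chart at `u`: the
derivative of that chart. -/
def chartVec (u w : FrameBundle n M) : TangentSpace (frameI n) w →L[ℝ] FrameModel n :=
  mvfderiv (frameI n) (extChartAt (frameI n) u) w

variable {g : ContMDiffRiemannianMetric (𝓡 n) ∞ (EuclideanSpace ℝ (Fin n))
      (TangentSpace (𝓡 n) : M → Type _)}
    {cov : CovariantDerivative (𝓡 n) (EuclideanSpace ℝ (Fin n))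
      (TangentSpace (𝓡 n) : M → Type _)}

theorem chartVec_eq {u w : FrameBundle n M}
    (h : w.proj ∈ (chartAt (EuclideanSpace ℝ (Fin n)) u.proj).source)
    (A : TangentSpace (frameI n) w) :
    chartVec u w A = (coordL u.proj w.proj (split cov w A).1,
      mvfderiv (frameI n) (frameCoord u.proj) w A) := by
  have h1 : HasMFDerivAt (𝓡 n) 𝓘(ℝ, EuclideanSpace ℝ (Fin n)) (extChartAt (𝓡 n) u.proj) w.proj
      (coordL u.proj w.proj) := by
    rw [coordL_eq_mfderiv h]
    exact (mdifferentiableAt_extChartAt h).hasMFDerivAt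
  have h2 : HasMFDerivAt (frameI n) 𝓘(ℝ, FrameModel n) (fun w' : FrameBundle n M =>
      (extChartAt (𝓡 n) u.proj w'.proj, frameCoord u.proj w')) w
      (((coordL u.proj w.proj).comp (mfderiv (frameI n) (𝓡 n) proj w)).prod
        (mvfderiv (frameI n) (frameCoord u.proj) w)) := by
    have h2 := (h1.comp w (mdifferentiableAt_proj w).hasMFDerivAt).prodMk
      (mdifferentiableAt_frameCoord h).hasMFDerivAt
    rw [← modelWithCornersSelf_prod] at h2
    exact h2
  have h3 : extChartAt (frameI n) u =ᶠ[𝓝 w] fun w' =>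
      (extChartAt (𝓡 n) u.proj w'.proj, frameCoord u.proj w') :=
    (eventually_proj_mem h).mono fun w' hw' => extChartAt_eq hw'
  have h4 := (h2.congr_of_eventuallyEq h3).mfderiv
  exact congrArg (fun L => L A) h4

/-- In a chart, the component of `A` along the frame vector `w_i` is `K (R_i)_* A` minus the
Christoffel term `Γ(π_* A, w_i)`. -/
theorem mvfderiv_frameCoord_single (hcov : IsLeviCivita (fun x v w => g.inner x v w) cov)
    {x₀ : M} {w : FrameBundle n M}
    (h : w.proj ∈ (chartAt (EuclideanSpace ℝ (Fin n)) x₀).source)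
    (A : TangentSpace (frameI n) w) (i : Fin n) :
    mvfderiv (frameI n) (frameCoord x₀) w A (EuclideanSpace.single i 1) =
      coordL x₀ w.proj ((split cov w A).2 i) -
        chartChristoffel g x₀ (extChartAt (𝓡 n) x₀ w.proj)
          (coordL x₀ w.proj (split cov w A).1) (coordL x₀ w.proj (w.vec i)) := by
  have hK := coordL_connectionMap hcov (toTangent i w) h
    (mfderiv (frameI n) (𝓡 n).tangent (toTangent i) w A)
  have hp : mfderiv (𝓡 n).tangent (𝓡 n) (fun η : TangentBundle (𝓡 n) M => η.1) (toTangent i w)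
      (mfderiv (frameI n) (𝓡 n).tangent (toTangent i) w A) = (split cov w A).1 := by
    have := mfderiv_comp w (Bundle.mdifferentiableAt_proj (TangentSpace (𝓡 n) : M → Type _))
      (mdifferentiableAt_toTangent i w)
    exact (congrArg (fun L => L A) this).symm
  have hf : HasMFDerivAt (frameI n) 𝓘(ℝ, EuclideanSpace ℝ (Fin n))
      (fun w' : FrameBundle n M => fiberCoord n M x₀ (toTangent i w')) w _ :=
    HasMFDerivAt.comp (I' := (𝓡 n).tangent) (g := fiberCoord n M x₀) (f := toTangent i) w
      (mdifferentiableAt_fiberCoord h).hasMFDerivAt (mdifferentiableAt_toTangent i w).hasMFDerivAt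
  have hc : HasMFDerivAt (frameI n) 𝓘(ℝ, EuclideanSpace ℝ (Fin n))
      (fun w' => frameCoord x₀ w' (EuclideanSpace.single i (1 : ℝ))) w
      ((ContinuousLinearMap.apply ℝ (EuclideanSpace ℝ (Fin n))
        (EuclideanSpace.single i (1 : ℝ))).comp (mvfderiv (frameI n) (frameCoord x₀) w)) :=
    HasMFDerivAt.comp (I' := 𝓘(ℝ, EuclideanSpace ℝ (Fin n) →L[ℝ] EuclideanSpace ℝ (Fin n))) w
      (ContinuousLinearMap.apply ℝ (EuclideanSpace ℝ (Fin n))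
        (EuclideanSpace.single i (1 : ℝ))).hasMFDerivAt
      (mdifferentiableAt_frameCoord h).hasMFDerivAt
  have heq : (fun w' : FrameBundle n M => frameCoord x₀ w' (EuclideanSpace.single i (1 : ℝ)))
      =ᶠ[𝓝 w] fun w' => fiberCoord n M x₀ (toTangent i w') := by
    filter_upwards [eventually_proj_mem h] with w' hw'
    rw [frameCoord_single hw', fiberCoord_eq_coordL hw']
    rfl
  have hfin := congrArg (fun L => L A) (hasMFDerivAt_unique hc (hf.congr_of_eventuallyEq heq))
  have hfin' : mvfderiv (frameI n) (frameCoord x₀) w A (EuclideanSpace.single i 1) =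
      mvfderiv (𝓡 n).tangent (fiberCoord n M x₀) (toTangent i w)
        (mfderiv (frameI n) (𝓡 n).tangent (toTangent i) w A) := hfin
  have hK' : coordL x₀ w.proj ((split cov w A).2 i) =
      mvfderiv (𝓡 n).tangent (fiberCoord n M x₀) (toTangent i w)
        (mfderiv (frameI n) (𝓡 n).tangent (toTangent i) w A) +
      chartChristoffel g x₀ (extChartAt (𝓡 n) x₀ w.proj)
        (coordL x₀ w.proj (split cov w A).1) (coordL x₀ w.proj (w.vec i)) := by
    rw [← hp]
    exact hK
  rw [hfin', hK', add_sub_cancel_right]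

end FrameBundle

/-! ### Lifted vector fields in a chart, and their brackets -/

namespace FrameBundle

variable {n : ℕ} {M : Type*} [TopologicalSpace M]
  [ChartedSpace (EuclideanSpace ℝ (Fin n)) M] [IsManifold (𝓡 n) ∞ M]
  {g : ContMDiffRiemannianMetric (𝓡 n) ∞ (EuclideanSpace ℝ (Fin n))
      (TangentSpace (𝓡 n) : M → Type _)}
    {cov : CovariantDerivative (𝓡 n) (EuclideanSpace ℝ (Fin n))
      (TangentSpace (𝓡 n) : M → Type _)}

@[simp]
theorem split_hLift (u : FrameBundle n M) (v : TangentSpace (𝓡 n) u.proj) :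
    split cov u (hLift cov u v) = (v, 0) :=
  LinearEquiv.apply_symm_apply _ _

@[simp]
theorem split_vLift (i : Fin n) (u : FrameBundle n M) (v : TangentSpace (𝓡 n) u.proj) :
    split cov u (vLift cov i u v) = (0, Pi.single i v) :=
  LinearEquiv.apply_symm_apply _ _

theorem clm_ext_single {F : Type*} [NormedAddCommGroup F] [NormedSpace ℝ F]
    {L L' : EuclideanSpace ℝ (Fin n) →L[ℝ] F}
    (h : ∀ i, L (EuclideanSpace.single i 1) = L' (EuclideanSpace.single i 1)) : L = L' := by
  refine ContinuousLinearMap.coe_injective ?_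
  refine (EuclideanSpace.basisFun (Fin n) ℝ).toBasis.ext fun i => ?_
  simpa using h i

theorem chartVec_hLift (hcov : IsLeviCivita (fun x v w => g.inner x v w) cov)
    {u w : FrameBundle n M}
    (h : w.proj ∈ (chartAt (EuclideanSpace ℝ (Fin n)) u.proj).source)
    (v : TangentSpace (𝓡 n) w.proj) {a : EuclideanSpace ℝ (Fin n) → EuclideanSpace ℝ (Fin n)}
    (ha : coordL u.proj w.proj v = a (extChartAt (𝓡 n) u.proj w.proj)) :
    chartVec u w (hLift cov w v) =
      hRep n (chartChristoffel g u.proj) a (extChartAt (frameI n) u w) := by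
  rw [chartVec_eq (cov := cov) h, extChartAt_eq h]
  refine Prod.ext ?_ (clm_ext_single fun i => ?_)
  · simp only [split_hLift, hRep, ha]
  · rw [mvfderiv_frameCoord_single hcov h]
    simp only [split_hLift, hRep, ha, Pi.zero_apply, map_zero, zero_sub, neg_apply,
      ContinuousLinearMap.comp_apply, frameCoord_single h]

theorem chartVec_vLift (hcov : IsLeviCivita (fun x v w => g.inner x v w) cov)
    {u w : FrameBundle n M}
    (h : w.proj ∈ (chartAt (EuclideanSpace ℝ (Fin n)) u.proj).source) (i : Fin n)
    (v : TangentSpace (𝓡 n) w.proj) {a : EuclideanSpace ℝ (Fin n) → EuclideanSpace ℝ (Fin n)}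
    (ha : coordL u.proj w.proj v = a (extChartAt (𝓡 n) u.proj w.proj)) :
    chartVec u w (vLift cov i w v) = vRep i a (extChartAt (frameI n) u w) := by
  rw [chartVec_eq (cov := cov) h, extChartAt_eq h]
  refine Prod.ext ?_ (clm_ext_single fun j => ?_)
  · simp only [split_vLift, vRep, map_zero]
  · rw [mvfderiv_frameCoord_single hcov h]
    simp only [split_vLift, vRep, map_zero, zero_apply, sub_zero,
      ContinuousLinearMap.smulRight_apply, ← ha]
    rcases eq_or_ne j i with rfl | hji
    · simp
    · simp [hji.symm]

/-- Reading off the decomposition of a tangent vector from its components. -/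
theorem coordL_split (hcov : IsLeviCivita (fun x v w => g.inner x v w) cov) {u : FrameBundle n M}
    {A : TangentSpace (frameI n) u} {D : FrameModel n} (hA : chartVec u u A = D) :
    coordL u.proj u.proj (split cov u A).1 = D.1 ∧
    ∀ i, coordL u.proj u.proj ((split cov u A).2 i) = D.2 (EuclideanSpace.single i 1) +
      chartChristoffel g u.proj (extChartAt (𝓡 n) u.proj u.proj) D.1
        (coordL u.proj u.proj (u.vec i)) := by
  have h := mem_chart_source (EuclideanSpace ℝ (Fin n)) u.proj
  subst hA
  rw [chartVec_eq (cov := cov) h]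
  refine ⟨rfl, fun i => ?_⟩
  rw [mvfderiv_frameCoord_single hcov h, sub_add_cancel]

theorem split_ext {u : FrameBundle n M} {A : TangentSpace (frameI n) u}
    {v : TangentSpace (𝓡 n) u.proj} {κ : Fin n → TangentSpace (𝓡 n) u.proj}
    (h1 : coordL u.proj u.proj (split cov u A).1 = coordL u.proj u.proj v)
    (h2 : ∀ i, coordL u.proj u.proj ((split cov u A).2 i) = coordL u.proj u.proj (κ i)) :
    split cov u A = (v, κ) :=
  have h := mem_chart_source (EuclideanSpace ℝ (Fin n)) u.proj
  Prod.ext (coordL_injective h h1) (funext fun i => coordL_injective h (h2 i))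

section Fields

variable {u : FrameBundle n M} {X Y : ∀ x : M, TangentSpace (𝓡 n) x}

theorem eventually_chartVec_hField (hcov : IsLeviCivita (fun x v w => g.inner x v w) cov)
    {a : EuclideanSpace ℝ (Fin n) → EuclideanSpace ℝ (Fin n)}
    (ha : ∀ᶠ z in 𝓝 u.proj, coordL u.proj z (X z) = a (extChartAt (𝓡 n) u.proj z)) :
    ∀ᶠ w : FrameBundle n M in 𝓝 u, chartVec u w (hField cov X w) =
      hRep n (chartChristoffel g u.proj) a (extChartAt (frameI n) u w) := by
  filter_upwards [eventually_proj_mem (mem_chart_source (EuclideanSpace ℝ (Fin n)) u.proj),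
    (mdifferentiableAt_proj u).continuousAt.eventually ha] with w hw haw
  exact chartVec_hLift hcov hw _ haw

theorem eventually_chartVec_vField (hcov : IsLeviCivita (fun x v w => g.inner x v w) cov)
    (i : Fin n) {a : EuclideanSpace ℝ (Fin n) → EuclideanSpace ℝ (Fin n)}
    (ha : ∀ᶠ z in 𝓝 u.proj, coordL u.proj z (X z) = a (extChartAt (𝓡 n) u.proj z)) :
    ∀ᶠ w : FrameBundle n M in 𝓝 u, chartVec u w (vField cov i X w) =
      vRep i a (extChartAt (frameI n) u w) := by
  filter_upwards [eventually_proj_mem (mem_chart_source (EuclideanSpace ℝ (Fin n)) u.proj),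
    (mdifferentiableAt_proj u).continuousAt.eventually ha] with w hw haw
  exact chartVec_vLift hcov hw i _ haw

theorem mdifferentiableAt_of_chartVec {V : ∀ w : FrameBundle n M, TangentSpace (frameI n) w}
    {V' : FrameModel n → FrameModel n}
    (hV : ∀ᶠ w in 𝓝 u, chartVec u w (V w) = V' (extChartAt (frameI n) u w))
    (hV' : DifferentiableAt ℝ V' (extChartAt (frameI n) u u)) :
    MDifferentiableAt (frameI n) (frameI n).tangent
      (fun w => (⟨w, V w⟩ : TangentBundle (frameI n) (FrameBundle n M))) u :=
  mdifferentiableAt_of_rep (I := frameI n) (N := FrameBundle n M) (x₀ := u)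
    (mem_chart_source _ u) (V' := V') hV hV'

theorem chartVec_mlieBracket {V W : ∀ w : FrameBundle n M, TangentSpace (frameI n) w}
    {V' W' : FrameModel n → FrameModel n}
    (hV : ∀ᶠ w in 𝓝 u, chartVec u w (V w) = V' (extChartAt (frameI n) u w))
    (hW : ∀ᶠ w in 𝓝 u, chartVec u w (W w) = W' (extChartAt (frameI n) u w))
    (hV' : DifferentiableAt ℝ V' (extChartAt (frameI n) u u))
    (hW' : DifferentiableAt ℝ W' (extChartAt (frameI n) u u)) :
    chartVec u u (VectorField.mlieBracket (frameI n) V W u) =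
      VectorField.lieBracket ℝ V' W' (extChartAt (frameI n) u u) :=
  mfderiv_extChartAt_mlieBracket (I := frameI n) (N := FrameBundle n M) (x₀ := u)
    (mem_chart_source _ u) (V' := V') (W' := W') hV hW hV' hW'

theorem extChartAt_self (u : FrameBundle n M) :
    extChartAt (frameI n) u u = (extChartAt (𝓡 n) u.proj u.proj, frameCoord u.proj u) :=
  extChartAt_eq (mem_chart_source _ u.proj)

theorem differentiableAt_chartChristoffel (g : ContMDiffRiemannianMetric (𝓡 n) ∞
    (EuclideanSpace ℝ (Fin n)) (TangentSpace (𝓡 n) : M → Type _)) (u : FrameBundle n M) :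
    DifferentiableAt ℝ (chartChristoffel g u.proj) (extChartAt (frameI n) u u).1 := by
  rw [extChartAt_self]
  exact (isMetricOn_metricRep g u.proj).differentiableAt_christoffel
    (extChartAt_mem_target (mem_chart_source _ u.proj))

theorem differentiableAt_rep_fst
    {F : Type*} [NormedAddCommGroup F] [NormedSpace ℝ F] {a : EuclideanSpace ℝ (Fin n) → F}
    (ha : DifferentiableAt ℝ a (extChartAt (𝓡 n) u.proj u.proj)) :
    DifferentiableAt ℝ a (extChartAt (frameI n) u u).1 := by
  rwa [extChartAt_self]

variable (hcov : IsLeviCivita (fun x v w => g.inner x v w) cov)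
  (hX : MDifferentiableAt (𝓡 n) (𝓡 n).tangent
      (fun y => (⟨y, X y⟩ : TangentBundle (𝓡 n) M)) u.proj)
  (hY : MDifferentiableAt (𝓡 n) (𝓡 n).tangent
      (fun y => (⟨y, Y y⟩ : TangentBundle (𝓡 n) M)) u.proj)
include hcov hX

theorem mdifferentiableAt_hField :
    MDifferentiableAt (frameI n) (frameI n).tangent
      (fun w => (⟨w, hField cov X w⟩ : TangentBundle (frameI n) (FrameBundle n M))) u := by
  obtain ⟨a, ha, ha'⟩ := exists_rep_field hX
  exact mdifferentiableAt_of_chartVec (eventually_chartVec_hField hcov ha')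
    (differentiableAt_hRep (differentiableAt_chartChristoffel g u) (differentiableAt_rep_fst ha))

theorem mdifferentiableAt_vField (i : Fin n) :
    MDifferentiableAt (frameI n) (frameI n).tangent
      (fun w => (⟨w, vField cov i X w⟩ : TangentBundle (frameI n) (FrameBundle n M))) u := by
  obtain ⟨a, ha, ha'⟩ := exists_rep_field hX
  exact mdifferentiableAt_of_chartVec (eventually_chartVec_vField hcov i ha')
    (differentiableAt_vRep i (differentiableAt_rep_fst ha))

include hY

/-- `[X^h, Y^h] = [X, Y]^h - ∑ k, (R(X, Y) u_k)^{v,k}`. -/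
theorem split_mlieBracket_hField_hField :
    split cov u (VectorField.mlieBracket (frameI n) (hField cov X) (hField cov Y) u) =
      (cov Y u.proj (X u.proj) - cov X u.proj (Y u.proj),
        fun k => -curvatureAt cov u.proj (X u.proj) (Y u.proj) (u.vec k)) := by
  have h := mem_chart_source (EuclideanSpace ℝ (Fin n)) u.proj
  obtain ⟨a, ha, ha'⟩ := exists_rep_field hX
  obtain ⟨b, hb, hb'⟩ := exists_rep_field hY
  have hΓ := differentiableAt_chartChristoffel g u
  have hA := differentiableAt_rep_fst ha
  have hB := differentiableAt_rep_fst hb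
  have hbr := chartVec_mlieBracket (eventually_chartVec_hField hcov ha')
    (eventually_chartVec_hField hcov hb') (differentiableAt_hRep hΓ hA)
    (differentiableAt_hRep hΓ hB)
  rw [lieBracket_hRep_hRep hΓ hA hB, extChartAt_self] at hbr
  obtain ⟨h1, h2⟩ := coordL_split hcov hbr
  have hΓs := (isMetricOn_metricRep g u.proj).christoffel_symm (extChartAt_mem_target h)
    (a (extChartAt (𝓡 n) u.proj u.proj)) (b (extChartAt (𝓡 n) u.proj u.proj))
  refine split_ext ?_ fun i => ?_
  · rw [h1, map_sub, coordL_cov_of_rep hcov h ha' ha, coordL_cov_of_rep hcov h hb' hb,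
      ha'.self_of_nhds, hb'.self_of_nhds]
    simp only [VectorField.lieBracket, chartChristoffel, hΓs]
    abel
  · rw [h2 i, map_neg, coordL_curvatureAt hcov, ha'.self_of_nhds, hb'.self_of_nhds]
    simp only [neg_apply, ContinuousLinearMap.comp_apply, add_apply, frameCoord_single h]
    abel

theorem mlieBracket_hField_vField (i : Fin n) :
    VectorField.mlieBracket (frameI n) (hField cov X) (vField cov i Y) u =
      vLift cov i u (cov Y u.proj (X u.proj)) := by
  have h := mem_chart_source (EuclideanSpace ℝ (Fin n)) u.proj
  obtain ⟨a, ha, ha'⟩ := exists_rep_field hX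
  obtain ⟨b, hb, hb'⟩ := exists_rep_field hY
  have hΓ := differentiableAt_chartChristoffel g u
  have hA := differentiableAt_rep_fst ha
  have hB := differentiableAt_rep_fst hb
  have hbr := chartVec_mlieBracket (eventually_chartVec_hField hcov ha')
    (eventually_chartVec_vField hcov i hb') (differentiableAt_hRep hΓ hA)
    (differentiableAt_vRep i hB)
  rw [lieBracket_hRep_vRep i hΓ hA hB, extChartAt_self] at hbr
  obtain ⟨h1, h2⟩ := coordL_split hcov hbr
  refine (split cov u).injective ((split_ext ?_ fun j => ?_).trans (split_vLift i u _).symm)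
  · rw [h1, map_zero]
  · rw [h2 j]
    rcases eq_or_ne j i with rfl | hji
    · simp [coordL_cov_of_rep hcov h hb' hb, ha'.self_of_nhds]
    · simp [hji.symm]

theorem mlieBracket_vField_vField (i j : Fin n) :
    VectorField.mlieBracket (frameI n) (vField cov i X) (vField cov j Y) u = 0 := by
  obtain ⟨a, ha, ha'⟩ := exists_rep_field hX
  obtain ⟨b, hb, hb'⟩ := exists_rep_field hY
  have hA := differentiableAt_rep_fst ha
  have hB := differentiableAt_rep_fst hb
  have hbr := chartVec_mlieBracket (eventually_chartVec_vField hcov i ha')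
    (eventually_chartVec_vField hcov j hb') (differentiableAt_vRep i hA)
    (differentiableAt_vRep j hB)
  rw [lieBracket_vRep_vRep i j hA hB] at hbr
  obtain ⟨h1, h2⟩ := coordL_split hcov hbr
  refine (split cov u).injective ((split_ext (v := 0) (κ := 0) ?_ fun j => ?_).trans
    (map_zero (split cov u)).symm)
  · rw [h1, map_zero]
    rfl
  · rw [h2 j]
    simp

end Fields

end FrameBundle

/-! ### Derivatives of inner products on the frame bundle -/

namespace FrameBundle

variable {n : ℕ} {M : Type*} [TopologicalSpace M]
  [ChartedSpace (EuclideanSpace ℝ (Fin n)) M] [IsManifold (𝓡 n) ∞ M]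
  {g : ContMDiffRiemannianMetric (𝓡 n) ∞ (EuclideanSpace ℝ (Fin n))
      (TangentSpace (𝓡 n) : M → Type _)}
    {cov : CovariantDerivative (𝓡 n) (EuclideanSpace ℝ (Fin n))
      (TangentSpace (𝓡 n) : M → Type _)}
  {u : FrameBundle n M}

/-- The section `S` of `π^* TM` is differentiable at `u`, and its derivatives there with respect to
the pulled back connection `π^* ∇` are given by `DS`: in the chart at `u`, `DS A` is the derivative
of the components of `S` along `A` plus the Christoffel term. -/
structure HasCovDerivAt (g : ContMDiffRiemannianMetric (𝓡 n) ∞ (EuclideanSpace ℝ (Fin n))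
      (TangentSpace (𝓡 n) : M → Type _))
    (cov : CovariantDerivative (𝓡 n) (EuclideanSpace ℝ (Fin n))
      (TangentSpace (𝓡 n) : M → Type _))
    (S : ∀ w : FrameBundle n M, TangentSpace (𝓡 n) w.proj) (u : FrameBundle n M)
    (DS : TangentSpace (frameI n) u → TangentSpace (𝓡 n) u.proj) : Prop where
  exists_rep : ∃ S' : FrameModel n → EuclideanSpace ℝ (Fin n),
    DifferentiableAt ℝ S' (extChartAt (frameI n) u u) ∧
    (∀ᶠ w in 𝓝 u, coordL u.proj w.proj (S w) = S' (extChartAt (frameI n) u w)) ∧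
    ∀ A, coordL u.proj u.proj (DS A) =
      fderiv ℝ S' (extChartAt (frameI n) u u) (chartVec u u A) +
      chartChristoffel g u.proj (extChartAt (𝓡 n) u.proj u.proj)
        (coordL u.proj u.proj (split cov u A).1) (coordL u.proj u.proj (S u))

set_option maxHeartbeats 1000000 in
/-- `A (g(S, T)) = g(D_A S, T) + g(S, D_A T)`. -/
theorem hasMFDerivAt_inner {S T : ∀ w : FrameBundle n M, TangentSpace (𝓡 n) w.proj}
    {DS DT : TangentSpace (frameI n) u → TangentSpace (𝓡 n) u.proj}
    (hS : HasCovDerivAt g cov S u DS) (hT : HasCovDerivAt g cov T u DT) :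
    ∃ L : TangentSpace (frameI n) u →L[ℝ] ℝ,
      HasMFDerivAt (frameI n) 𝓘(ℝ, ℝ) (fun w => g.inner w.proj (S w) (T w)) u L ∧
      ∀ A, L A = g.inner u.proj (DS A) (T u) + g.inner u.proj (S u) (DT A) := by
  have h := mem_chart_source (EuclideanSpace ℝ (Fin n)) u.proj
  have hm := isMetricOn_metricRep g u.proj
  have hp := extChartAt_mem_target h
  obtain ⟨S', hS', hSe, hSd⟩ := hS
  obtain ⟨T', hT', hTe, hTd⟩ := hT
  have hG : HasFDerivAt (fun q : FrameModel n => metricRep g u.proj q.1)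
      ((fderiv ℝ (metricRep g u.proj) (extChartAt (𝓡 n) u.proj u.proj)).comp
        (ContinuousLinearMap.fst ℝ _ _)) (extChartAt (frameI n) u u) := by
    have h1 := hasFDerivAt_comp_fst (n := n) (q := extChartAt (frameI n) u u)
      (f := metricRep g u.proj) (differentiableAt_rep_fst (hm.differentiableAt hp))
    rw [extChartAt_self] at h1 ⊢
    exact h1
  have hrep : ∀ᶠ w in 𝓝 u, g.inner w.proj (S w) (T w) =
      (fun q : FrameModel n => metricRep g u.proj q.1 (S' q) (T' q))
        (extChartAt (frameI n) u w) := by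
    filter_upwards [hSe, hTe, eventually_proj_mem h] with w h1 h2 hw
    rw [inner_eq_metricRep g hw, h1, h2]
    simp only [extChartAt_eq hw]
  have hd : DifferentiableAt ℝ (fun q : FrameModel n => metricRep g u.proj q.1 (S' q) (T' q))
      (extChartAt (frameI n) u u) :=
    (hG.differentiableAt.clm_apply hS').clm_apply hT'
  refine ⟨_, hasMFDerivAt_of_rep (I := frameI n) (N := FrameBundle n M) (x₀ := u)
    (mem_chart_source _ u) hrep hd, fun A => ?_⟩
  change fderiv ℝ _ _ (chartVec u u A) = _
  have hc : (chartVec u u A).1 = coordL u.proj u.proj (split cov u A).1 := by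
    rw [chartVec_eq (cov := cov) h]
  rw [fderiv_bilin_apply hG.differentiableAt hS' hT', hG.fderiv, inner_eq_metricRep g h,
    inner_eq_metricRep g h, hSd, hTd, ← hSe.self_of_nhds, ← hTe.self_of_nhds]
  simp only [ContinuousLinearMap.comp_apply, ContinuousLinearMap.coe_fst', hc,
    hm.fderiv_eq_christoffel hp, map_add, add_apply, extChartAt_self u, chartChristoffel]
  ring

theorem hasCovDerivAt_comp_proj (hcov : IsLeviCivita (fun x v w => g.inner x v w) cov)
    {X : ∀ x : M, TangentSpace (𝓡 n) x}
    (hX : MDifferentiableAt (𝓡 n) (𝓡 n).tangent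
      (fun y => (⟨y, X y⟩ : TangentBundle (𝓡 n) M)) u.proj) :
    HasCovDerivAt g cov (fun w => X w.proj) u (fun A => cov X u.proj (split cov u A).1) := by
  have h := mem_chart_source (EuclideanSpace ℝ (Fin n)) u.proj
  obtain ⟨a, ha, ha'⟩ := exists_rep_field hX
  have hd := hasFDerivAt_comp_fst (n := n) (differentiableAt_rep_fst ha)
  refine ⟨fun q => a q.1, hd.differentiableAt, ?_, fun A => ?_⟩
  · filter_upwards [eventually_proj_mem h,
      (mdifferentiableAt_proj u).continuousAt.eventually ha'] with w hw haw
    rw [extChartAt_eq hw]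
    exact haw
  · rw [hd.fderiv, coordL_cov_of_rep hcov h ha' ha, ← ha'.self_of_nhds, extChartAt_self,
      chartVec_eq (cov := cov) h]
    rfl

theorem hasCovDerivAt_vec (hcov : IsLeviCivita (fun x v w => g.inner x v w) cov) (i : Fin n) :
    HasCovDerivAt g cov (fun w => w.vec i) u (fun A => (split cov u A).2 i) := by
  have h := mem_chart_source (EuclideanSpace ℝ (Fin n)) u.proj
  have hd : HasFDerivAt (fun q : FrameModel n => q.2 (EuclideanSpace.single i (1 : ℝ)))
      ((ContinuousLinearMap.apply ℝ (EuclideanSpace ℝ (Fin n))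
        (EuclideanSpace.single i (1 : ℝ))).comp (ContinuousLinearMap.snd ℝ _ _))
      (extChartAt (frameI n) u u) :=
    (ContinuousLinearMap.apply ℝ (EuclideanSpace ℝ (Fin n))
        (EuclideanSpace.single i (1 : ℝ))).hasFDerivAt.comp _ hasFDerivAt_snd
  refine ⟨fun q => q.2 (EuclideanSpace.single i 1), hd.differentiableAt, ?_, fun A => ?_⟩
  · filter_upwards [eventually_proj_mem h] with w hw
    rw [extChartAt_eq hw, frameCoord_single hw]
  · rw [hd.fderiv, (coordL_split hcov rfl).2 i]
    congr 3
    rw [chartVec_eq (cov := cov) h]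

theorem vec_ne_zero (u : FrameBundle n M) (i : Fin n) : u.vec i ≠ 0 := by
  obtain ⟨f, hf⟩ := u.2
  intro h0
  have h1 : f (EuclideanSpace.single i (1 : ℝ)) = 0 :=
    (congrArg (fun L => L (EuclideanSpace.single i (1 : ℝ))) hf).trans h0
  have h2 := f.injective (h1.trans (map_zero f).symm)
  have h3 := congrArg (fun x : EuclideanSpace ℝ (Fin n) => x i) h2
  simp at h3

theorem normSq_pos (g : ContMDiffRiemannianMetric (𝓡 n) ∞ (EuclideanSpace ℝ (Fin n))
      (TangentSpace (𝓡 n) : M → Type _)) (u : FrameBundle n M) (i : Fin n) :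
    0 < normSq g u i :=
  g.pos _ _ (vec_ne_zero u i)

variable {α β : ℝ → ℝ}

theorem hasMFDerivAt_comp_normSq (hcov : IsLeviCivita (fun x v w => g.inner x v w) cov)
    (i : Fin n) (hα : DifferentiableAt ℝ α (normSq g u i)) :
    ∃ L : TangentSpace (frameI n) u →L[ℝ] ℝ,
      HasMFDerivAt (frameI n) 𝓘(ℝ, ℝ) (fun w => α (normSq g w i)) u L ∧
      ∀ A, L A = deriv α (normSq g u i) *
        (2 * g.inner u.proj ((split cov u A).2 i) (u.vec i)) := by
  obtain ⟨L, hL, hL'⟩ := hasMFDerivAt_inner (hasCovDerivAt_vec hcov i)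
    (hasCovDerivAt_vec (u := u) hcov i)
  have hα' : HasMFDerivAt 𝓘(ℝ, ℝ) 𝓘(ℝ, ℝ) α (normSq g u i) (fderiv ℝ α (normSq g u i)) :=
    hα.hasFDerivAt.hasMFDerivAt
  refine ⟨_, HasMFDerivAt.comp (g := α) u hα' hL, fun A => ?_⟩
  change fderiv ℝ α (normSq g u i) (L A) = _
  rw [fderiv_eq_smul_deriv, hL' A, g.symm u.proj (u.vec i), smul_eq_mul]
  ring

set_option maxHeartbeats 1000000 in
/-- The derivative of `ḡ(Y^{v,i}, Z^{v,i})`. -/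
theorem mvfderiv_metric_vField_vField (hcov : IsLeviCivita (fun x v w => g.inner x v w) cov)
    (i : Fin n) (hα : DifferentiableAt ℝ α (normSq g u i))
    (hβ : DifferentiableAt ℝ β (normSq g u i)) {Y Z : ∀ x : M, TangentSpace (𝓡 n) x}
    (hY : MDifferentiableAt (𝓡 n) (𝓡 n).tangent
      (fun y => (⟨y, Y y⟩ : TangentBundle (𝓡 n) M)) u.proj)
    (hZ : MDifferentiableAt (𝓡 n) (𝓡 n).tangent
      (fun y => (⟨y, Z y⟩ : TangentBundle (𝓡 n) M)) u.proj) (A : TangentSpace (frameI n) u)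
    {a b y z κ : TangentSpace (𝓡 n) u.proj} (hy : cov Y u.proj (split cov u A).1 = a)
    (hz : cov Z u.proj (split cov u A).1 = b) (hκ : (split cov u A).2 i = κ)
    (hYy : Y u.proj = y) (hZz : Z u.proj = z) :
    mvfderiv (frameI n) (fun w => metric g cov α β w (vField cov i Y w) (vField cov i Z w)) u A =
      deriv α (normSq g u i) * (2 * g.inner u.proj κ (u.vec i)) * g.inner u.proj y z +
      α (normSq g u i) * (g.inner u.proj a z + g.inner u.proj y b) +
      deriv β (normSq g u i) * (2 * g.inner u.proj κ (u.vec i)) *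
        (g.inner u.proj y (u.vec i) * g.inner u.proj z (u.vec i)) +
      β (normSq g u i) *
        ((g.inner u.proj a (u.vec i) + g.inner u.proj y κ) * g.inner u.proj z (u.vec i) +
          g.inner u.proj y (u.vec i) * (g.inner u.proj b (u.vec i) + g.inner u.proj z κ)) := by
  subst hy hz hκ hYy hZz
  obtain ⟨La, hLa, hLa'⟩ := hasMFDerivAt_comp_normSq hcov i hα
  obtain ⟨Lb, hLb, hLb'⟩ := hasMFDerivAt_comp_normSq hcov i hβ
  obtain ⟨L1, hL1, hL1'⟩ := hasMFDerivAt_inner (hasCovDerivAt_comp_proj hcov hY)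
    (hasCovDerivAt_comp_proj hcov hZ)
  obtain ⟨L2, hL2, hL2'⟩ := hasMFDerivAt_inner (hasCovDerivAt_comp_proj hcov hY)
    (hasCovDerivAt_vec hcov i)
  obtain ⟨L3, hL3, hL3'⟩ := hasMFDerivAt_inner (hasCovDerivAt_comp_proj hcov hZ)
    (hasCovDerivAt_vec hcov i)
  have hfin := ((hLa.mul' hL1).add (hLb.mul' (hL2.mul' hL3)))
  have hfun : (fun w => metric g cov α β w (vField cov i Y w) (vField cov i Z w)) =
      (fun w => α (normSq g w i)) * (fun w => g.inner w.proj (Y w.proj) (Z w.proj)) +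
      (fun w => β (normSq g w i)) * ((fun w => g.inner w.proj (Y w.proj) (w.vec i)) *
        (fun w => g.inner w.proj (Z w.proj) (w.vec i))) := by
    funext w
    exact metric_vLift_vLift ..
  have hval : mvfderiv (frameI n)
      (fun w => metric g cov α β w (vField cov i Y w) (vField cov i Z w)) u A = _ :=
    congrArg (fun L => L A) ((hfun ▸ hfin).mfderiv)
  refine hval.trans ?_
  change α (normSq g u i) * L1 A + La A * g.inner u.proj (Y u.proj) (Z u.proj) +
    (β (normSq g u i) * (g.inner u.proj (Y u.proj) (u.vec i) * L3 A +
      L2 A * g.inner u.proj (Z u.proj) (u.vec i)) +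
      Lb A * (g.inner u.proj (Y u.proj) (u.vec i) * g.inner u.proj (Z u.proj) (u.vec i))) = _
  rw [hLa', hLb', hL1', hL2', hL3']
  ring

theorem mvfderiv_metric_hField_hField (hcov : IsLeviCivita (fun x v w => g.inner x v w) cov)
    {Y Z : ∀ x : M, TangentSpace (𝓡 n) x}
    (hY : MDifferentiableAt (𝓡 n) (𝓡 n).tangent
      (fun y => (⟨y, Y y⟩ : TangentBundle (𝓡 n) M)) u.proj)
    (hZ : MDifferentiableAt (𝓡 n) (𝓡 n).tangent
      (fun y => (⟨y, Z y⟩ : TangentBundle (𝓡 n) M)) u.proj) (A : TangentSpace (frameI n) u)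
    {a b y z : TangentSpace (𝓡 n) u.proj} (hy : cov Y u.proj (split cov u A).1 = a)
    (hz : cov Z u.proj (split cov u A).1 = b) (hYy : Y u.proj = y) (hZz : Z u.proj = z) :
    mvfderiv (frameI n) (fun w => metric g cov α β w (hField cov Y w) (hField cov Z w)) u A =
      g.inner u.proj a z + g.inner u.proj y b := by
  subst hy hz hYy hZz
  obtain ⟨L1, hL1, hL1'⟩ := hasMFDerivAt_inner (hasCovDerivAt_comp_proj hcov hY)
    (hasCovDerivAt_comp_proj hcov hZ)
  have hfun : (fun w => metric g cov α β w (hField cov Y w) (hField cov Z w)) =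
      fun w => g.inner w.proj (Y w.proj) (Z w.proj) := by
    funext w
    exact metric_hLift_hLift ..
  rw [hfun, ← hL1' A]
  exact congrArg (fun L => L A) hL1.mfderiv

end FrameBundle

/-! ### Symmetries of the curvature -/

section Curvature

variable {n : ℕ} {M : Type*} [TopologicalSpace M]
  [ChartedSpace (EuclideanSpace ℝ (Fin n)) M] [IsManifold (𝓡 n) ∞ M]
  {g : ContMDiffRiemannianMetric (𝓡 n) ∞ (EuclideanSpace ℝ (Fin n))
      (TangentSpace (𝓡 n) : M → Type _)}
    {cov : CovariantDerivative (𝓡 n) (EuclideanSpace ℝ (Fin n))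
      (TangentSpace (𝓡 n) : M → Type _)}
  (hcov : IsLeviCivita (fun x v w => g.inner x v w) cov) {x : M}
  (a b c d : TangentSpace (𝓡 n) x)
include hcov

theorem inner_curvatureAt_skew :
    g.inner x (curvatureAt cov x a b c) d = -g.inner x (curvatureAt cov x a b d) c := by
  have h := mem_chart_source (EuclideanSpace ℝ (Fin n)) x
  have hm := isMetricOn_metricRep g x
  have hp := extChartAt_mem_target h
  rw [inner_eq_metricRep g h, inner_eq_metricRep g h, coordL_curvatureAt hcov,
    coordL_curvatureAt hcov, hm.symm _ hp _ (coordL x x c)]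
  exact hm.inner_riemann_skew hp ..

theorem inner_curvatureAt_pair_symm :
    g.inner x (curvatureAt cov x a b c) d = g.inner x (curvatureAt cov x c d a) b := by
  have h := mem_chart_source (EuclideanSpace ℝ (Fin n)) x
  have hm := isMetricOn_metricRep g x
  have hp := extChartAt_mem_target h
  rw [inner_eq_metricRep g h, inner_eq_metricRep g h, coordL_curvatureAt hcov,
    coordL_curvatureAt hcov]
  exact hm.inner_riemann_pair_symm hp ..

end Curvature

/-! ### The Koszul formula on the frame bundle -/

namespace FrameBundle

variable {n : ℕ} {M : Type*} [TopologicalSpace M]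
  [ChartedSpace (EuclideanSpace ℝ (Fin n)) M] [IsManifold (𝓡 n) ∞ M]
  {g : ContMDiffRiemannianMetric (𝓡 n) ∞ (EuclideanSpace ℝ (Fin n))
      (TangentSpace (𝓡 n) : M → Type _)}
    {cov : CovariantDerivative (𝓡 n) (EuclideanSpace ℝ (Fin n))
      (TangentSpace (𝓡 n) : M → Type _)}
  {u : FrameBundle n M} {α β : ℝ → ℝ}

theorem metric_comm (A B : TangentSpace (frameI n) u) :
    metric g cov α β u A B = metric g cov α β u B A := by
  simp only [metric]
  rw [g.symm]
  congr 1
  refine Finset.sum_congr rfl fun i _ => ?_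
  rw [g.symm _ ((split cov u A).2 i) ((split cov u B).2 i)]
  ring

theorem metric_sub_left (A B C : TangentSpace (frameI n) u) :
    metric g cov α β u (A - B) C = metric g cov α β u A C - metric g cov α β u B C := by
  simp only [metric, map_sub, Prod.fst_sub, Prod.snd_sub, Pi.sub_apply, sub_apply]
  rw [add_sub_add_comm, ← Finset.sum_sub_distrib]
  congr 1
  refine Finset.sum_congr rfl fun i _ => ?_
  ring

theorem metric_hLift_right (A : TangentSpace (frameI n) u) (z : TangentSpace (𝓡 n) u.proj) :
    metric g cov α β u A (hLift cov u z) = g.inner u.proj (split cov u A).1 z := by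
  simp [metric]

theorem metric_vLift_right (A : TangentSpace (frameI n) u) (k : Fin n)
    (z : TangentSpace (𝓡 n) u.proj) :
    metric g cov α β u A (vLift cov k u z) =
      α (normSq g u k) * g.inner u.proj ((split cov u A).2 k) z +
      β (normSq g u k) * (g.inner u.proj ((split cov u A).2 k) (u.vec k) *
        g.inner u.proj z (u.vec k)) := by
  simp only [metric, split_vLift, map_zero, zero_add]
  rw [Finset.sum_eq_single k]
  · simp
  · intro j _ hj
    simp [Pi.single_eq_of_ne hj]
  · simp

/-- Nondegeneracy of `ḡ`. On the `k`-th vertical space it has the eigenvalues `α` on the complement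
of `u_k` and `α + t β` on the line of `u_k`, relative to `g`. -/
theorem eq_of_metric_eq (hα_pos : ∀ t : ℝ, 0 < t → 0 < α t)
    (hαβ_pos : ∀ t : ℝ, 0 < t → 0 < α t + t * β t) {A B : TangentSpace (frameI n) u}
    (hh : ∀ z, metric g cov α β u A (hLift cov u z) = metric g cov α β u B (hLift cov u z))
    (hv : ∀ k z, metric g cov α β u A (vLift cov k u z) =
      metric g cov α β u B (vLift cov k u z)) : A = B := by
  rw [← sub_eq_zero]
  set D := A - B with hD
  have hh' : ∀ z, g.inner u.proj (split cov u D).1 z = 0 := fun z => by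
    rw [← metric_hLift_right (α := α) (β := β), hD, metric_sub_left, hh, sub_self]
  have hv' : ∀ k z, α (normSq g u k) * g.inner u.proj ((split cov u D).2 k) z +
      β (normSq g u k) * (g.inner u.proj ((split cov u D).2 k) (u.vec k) *
        g.inner u.proj z (u.vec k)) = 0 := fun k z => by
    rw [← metric_vLift_right, hD, metric_sub_left, hv, sub_self]
  have hzero : ∀ v : TangentSpace (𝓡 n) u.proj, g.inner u.proj v v = 0 → v = 0 := by
    intro v h
    by_contra hne
    exact (g.pos _ v hne).ne' h
  refine (split cov u).injective ((Prod.ext (hzero _ (hh' _)) (funext fun k => ?_)).trans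
    (map_zero (split cov u)).symm)
  have ht := normSq_pos g u k
  have h1 := hv' k (u.vec k)
  have h2 : g.inner u.proj ((split cov u D).2 k) (u.vec k) = 0 := by
    have h3 : (α (normSq g u k) + normSq g u k * β (normSq g u k)) *
        g.inner u.proj ((split cov u D).2 k) (u.vec k) = 0 := by
      rw [← h1]
      simp only [normSq]
      ring
    exact (mul_eq_zero.1 h3).resolve_left (hαβ_pos _ ht).ne'
  refine hzero _ ?_
  have h4 := hv' k ((split cov u D).2 k)
  rw [h2, zero_mul, mul_zero, add_zero] at h4
  exact (mul_eq_zero.1 h4).resolve_left (hα_pos _ ht).ne'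

theorem mvfderiv_eq_zero {f : FrameBundle n M → ℝ} (hf : ∀ w, f w = 0)
    (A : TangentSpace (frameI n) u) : mvfderiv (frameI n) f u A = 0 := by
  have h : f = fun _ => 0 := funext hf
  subst h
  exact congrArg (fun L => L A) (mfderiv_const (I := frameI n) (I' := 𝓘(ℝ, ℝ)) (c := (0 : ℝ))
    (x := u))

section Koszul

variable {nablaBar : CovariantDerivative (frameI n) (FrameModel n)
      (TangentSpace (frameI n) : FrameBundle n M → Type _)}

/-- The right-hand side of the Koszul formula. -/
def koszulForm (g : ContMDiffRiemannianMetric (𝓡 n) ∞ (EuclideanSpace ℝ (Fin n))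
      (TangentSpace (𝓡 n) : M → Type _))
    (cov : CovariantDerivative (𝓡 n) (EuclideanSpace ℝ (Fin n))
      (TangentSpace (𝓡 n) : M → Type _))
    (α β : ℝ → ℝ) (u : FrameBundle n M)
    (A B C : ∀ w : FrameBundle n M, TangentSpace (frameI n) w) : ℝ :=
  mvfderiv (frameI n) (fun w => metric g cov α β w (B w) (C w)) u (A u) +
  mvfderiv (frameI n) (fun w => metric g cov α β w (A w) (C w)) u (B u) -
  mvfderiv (frameI n) (fun w => metric g cov α β w (A w) (B w)) u (C u) +
  metric g cov α β u (VectorField.mlieBracket (frameI n) A B u) (C u) -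
  metric g cov α β u (VectorField.mlieBracket (frameI n) A C u) (B u) -
  metric g cov α β u (VectorField.mlieBracket (frameI n) B C u) (A u)

set_option maxHeartbeats 1000000 in
theorem koszul (hbar : IsLeviCivita (metric g cov α β) nablaBar)
    {A B C : ∀ w : FrameBundle n M, TangentSpace (frameI n) w}
    (hA : MDifferentiableAt (frameI n) (frameI n).tangent
      (fun w => (⟨w, A w⟩ : TangentBundle (frameI n) (FrameBundle n M))) u)
    (hB : MDifferentiableAt (frameI n) (frameI n).tangent
      (fun w => (⟨w, B w⟩ : TangentBundle (frameI n) (FrameBundle n M))) u)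
    (hC : MDifferentiableAt (frameI n) (frameI n).tangent
      (fun w => (⟨w, C w⟩ : TangentBundle (frameI n) (FrameBundle n M))) u) :
    2 * metric g cov α β u (nablaBar B u (A u)) (C u) = koszulForm g cov α β u A B C := by
  have h1 : mvfderiv (frameI n) (fun w => metric g cov α β w (B w) (C w)) u (A u) =
      metric g cov α β u (nablaBar B u (A u)) (C u) +
        metric g cov α β u (B u) (nablaBar C u (A u)) := hbar.metric B C u (A u) hB hC
  have h2 : mvfderiv (frameI n) (fun w => metric g cov α β w (A w) (C w)) u (B u) =
      metric g cov α β u (nablaBar A u (B u)) (C u) +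
        metric g cov α β u (A u) (nablaBar C u (B u)) := hbar.metric A C u (B u) hA hC
  have h3 : mvfderiv (frameI n) (fun w => metric g cov α β w (A w) (B w)) u (C u) =
      metric g cov α β u (nablaBar A u (C u)) (B u) +
        metric g cov α β u (A u) (nablaBar B u (C u)) := hbar.metric A B u (C u) hA hB
  have t1 : metric g cov α β u (VectorField.mlieBracket (frameI n) A B u) (C u) =
      metric g cov α β u (nablaBar B u (A u)) (C u) -
        metric g cov α β u (nablaBar A u (B u)) (C u) := by
    rw [← hbar.torsion_free A B u hA hB, metric_sub_left]
  have t2 : metric g cov α β u (VectorField.mlieBracket (frameI n) A C u) (B u) =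
      metric g cov α β u (nablaBar C u (A u)) (B u) -
        metric g cov α β u (nablaBar A u (C u)) (B u) := by
    rw [← hbar.torsion_free A C u hA hC, metric_sub_left]
  have t3 : metric g cov α β u (VectorField.mlieBracket (frameI n) B C u) (A u) =
      metric g cov α β u (nablaBar C u (B u)) (A u) -
        metric g cov α β u (nablaBar B u (C u)) (A u) := by
    rw [← hbar.torsion_free B C u hB hC, metric_sub_left]
  have c1 := metric_comm (g := g) (cov := cov) (α := α) (β := β) (B u) (nablaBar C u (A u))
  have c2 := metric_comm (g := g) (cov := cov) (α := α) (β := β) (A u) (nablaBar C u (B u))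
  have c3 := metric_comm (g := g) (cov := cov) (α := α) (β := β) (A u) (nablaBar B u (C u))
  rw [koszulForm, h1, h2, h3, t1, t2, t3, c1, c2, c3]
  ring

theorem exists_field (x : M) (z : TangentSpace (𝓡 n) x) :
    ∃ Z : ∀ x : M, TangentSpace (𝓡 n) x, Z x = z ∧ MDifferentiableAt (𝓡 n) (𝓡 n).tangent
      (fun y => (⟨y, Z y⟩ : TangentBundle (𝓡 n) M)) x :=
  have hx := mem_chart_source (EuclideanSpace ℝ (Fin n)) x
  ⟨constField x (coordL x x z), constField_coordL hx z, mdifferentiableAt_constField hx _⟩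

/-- The covariant derivative is determined by the Koszul formula, tested on lifts. -/
theorem nablaBar_eq (hcov : IsLeviCivita (fun x v w => g.inner x v w) cov)
    (hα_pos : ∀ t : ℝ, 0 < t → 0 < α t) (hαβ_pos : ∀ t : ℝ, 0 < t → 0 < α t + t * β t)
    (hbar : IsLeviCivita (metric g cov α β) nablaBar)
    {A B : ∀ w : FrameBundle n M, TangentSpace (frameI n) w}
    (hA : MDifferentiableAt (frameI n) (frameI n).tangent
      (fun w => (⟨w, A w⟩ : TangentBundle (frameI n) (FrameBundle n M))) u)
    (hB : MDifferentiableAt (frameI n) (frameI n).tangent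
      (fun w => (⟨w, B w⟩ : TangentBundle (frameI n) (FrameBundle n M))) u)
    {D : TangentSpace (frameI n) u}
    (hh : ∀ Z : ∀ x : M, TangentSpace (𝓡 n) x, MDifferentiableAt (𝓡 n) (𝓡 n).tangent
      (fun y => (⟨y, Z y⟩ : TangentBundle (𝓡 n) M)) u.proj →
      koszulForm g cov α β u A B (hField cov Z) = 2 * metric g cov α β u D (hField cov Z u))
    (hv : ∀ (k : Fin n) (Z : ∀ x : M, TangentSpace (𝓡 n) x),
      MDifferentiableAt (𝓡 n) (𝓡 n).tangent
      (fun y => (⟨y, Z y⟩ : TangentBundle (𝓡 n) M)) u.proj →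
      koszulForm g cov α β u A B (vField cov k Z) = 2 * metric g cov α β u D (vField cov k Z u)) :
    nablaBar B u (A u) = D := by
  refine eq_of_metric_eq (g := g) (cov := cov) hα_pos hαβ_pos (fun z => ?_) fun k z => ?_
  · obtain ⟨Z, rfl, hZ⟩ := exists_field u.proj z
    have h1 := (koszul hbar hA hB (mdifferentiableAt_hField hcov hZ)).trans (hh Z hZ)
    exact mul_left_cancel₀ two_ne_zero h1
  · obtain ⟨Z, rfl, hZ⟩ := exists_field u.proj z
    have h1 := (koszul hbar hA hB (mdifferentiableAt_vField hcov hZ k)).trans (hv k Z hZ)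
    exact mul_left_cancel₀ two_ne_zero h1

end Koszul

end FrameBundle

/-! ### The Koszul formula for lifted vector fields -/

namespace FrameBundle

variable {n : ℕ} {M : Type*} [TopologicalSpace M]
  [ChartedSpace (EuclideanSpace ℝ (Fin n)) M] [IsManifold (𝓡 n) ∞ M]
  {g : ContMDiffRiemannianMetric (𝓡 n) ∞ (EuclideanSpace ℝ (Fin n))
      (TangentSpace (𝓡 n) : M → Type _)}
    {cov : CovariantDerivative (𝓡 n) (EuclideanSpace ℝ (Fin n))
      (TangentSpace (𝓡 n) : M → Type _)}
  {u : FrameBundle n M} {α β : ℝ → ℝ} {X Y Z : ∀ x : M, TangentSpace (𝓡 n) x}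

theorem mvfderiv_metric_hField_vField (Y Z : ∀ x : M, TangentSpace (𝓡 n) x) (i : Fin n)
    (A : TangentSpace (frameI n) u) :
    mvfderiv (frameI n) (fun w => metric g cov α β w (hField cov Y w) (vField cov i Z w)) u A = 0 :=
  mvfderiv_eq_zero (fun w => metric_hLift_vLift g cov α β w _ _ i) A

theorem mvfderiv_metric_vField_hField (Y Z : ∀ x : M, TangentSpace (𝓡 n) x) (i : Fin n)
    (A : TangentSpace (frameI n) u) :
    mvfderiv (frameI n) (fun w => metric g cov α β w (vField cov i Y w) (hField cov Z w)) u A = 0 :=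
  mvfderiv_eq_zero (fun w => (metric_comm _ _).trans (metric_hLift_vLift g cov α β w _ _ i)) A

theorem mvfderiv_metric_vField_vField_of_ne (Y Z : ∀ x : M, TangentSpace (𝓡 n) x) {i j : Fin n}
    (hij : i ≠ j) (A : TangentSpace (frameI n) u) :
    mvfderiv (frameI n) (fun w => metric g cov α β w (vField cov i Y w) (vField cov j Z w)) u A =
      0 :=
  mvfderiv_eq_zero (fun w => metric_vLift_vLift_of_ne g cov α β w _ _ hij) A

variable (hcov : IsLeviCivita (fun x v w => g.inner x v w) cov)
  (hX : MDifferentiableAt (𝓡 n) (𝓡 n).tangent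
      (fun y => (⟨y, X y⟩ : TangentBundle (𝓡 n) M)) u.proj)
  (hY : MDifferentiableAt (𝓡 n) (𝓡 n).tangent
      (fun y => (⟨y, Y y⟩ : TangentBundle (𝓡 n) M)) u.proj)
  (hZ : MDifferentiableAt (𝓡 n) (𝓡 n).tangent
      (fun y => (⟨y, Z y⟩ : TangentBundle (𝓡 n) M)) u.proj)
include hcov hX hY

theorem mlieBracket_vField_hField (i : Fin n) :
    VectorField.mlieBracket (frameI n) (vField cov i X) (hField cov Y) u =
      -vLift cov i u (cov X u.proj (Y u.proj)) := by
  rw [VectorField.mlieBracket_swap_apply, mlieBracket_hField_vField hcov hY hX]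

/-- Along a vertical vector of another index, `ḡ(Y^{v,i}, Z^{v,i})` is constant. -/
theorem mvfderiv_metric_vField_vField_vField_of_ne {i j : Fin n} (hij : i ≠ j)
    (hα : DifferentiableAt ℝ α (normSq g u i)) (hβ : DifferentiableAt ℝ β (normSq g u i)) :
    mvfderiv (frameI n) (fun w => metric g cov α β w (vField cov i X w) (vField cov i Y w)) u
      (vField cov j Z u) = 0 := by
  rw [mvfderiv_metric_vField_vField hcov i hα hβ hX hY (vField cov j Z u)
      (a := 0) (b := 0) (κ := 0) (by rw [vField, split_vLift, map_zero])
      (by rw [vField, split_vLift, map_zero])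
      (by rw [vField, split_vLift]; exact Pi.single_eq_of_ne hij _) rfl rfl]
  simp only [map_zero, zero_apply]
  ring

include hZ

theorem koszulForm_hField_hField_hField :
    koszulForm g cov α β u (hField cov X) (hField cov Y) (hField cov Z) =
      2 * g.inner u.proj (cov Y u.proj (X u.proj)) (Z u.proj) := by
  simp only [koszulForm]
  rw [mvfderiv_metric_hField_hField hcov hY hZ _ rfl rfl rfl rfl,
    mvfderiv_metric_hField_hField hcov hX hZ _ rfl rfl rfl rfl,
    mvfderiv_metric_hField_hField hcov hX hY _ rfl rfl rfl rfl]
  simp only [hField, metric_hLift_right, split_hLift]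
  have h1 := congrArg Prod.fst (split_mlieBracket_hField_hField hcov hX hY)
  have h2 := congrArg Prod.fst (split_mlieBracket_hField_hField hcov hX hZ)
  have h3 := congrArg Prod.fst (split_mlieBracket_hField_hField hcov hY hZ)
  simp only at h1 h2 h3
  rw [h1, h2, h3]
  simp only [map_sub, sub_apply]
  rw [g.symm _ (cov Z u.proj (X u.proj)) (Y u.proj), g.symm _ (cov Z u.proj (Y u.proj)) (X u.proj),
    g.symm _ (cov Y u.proj (Z u.proj)) (X u.proj)]
  ring

theorem koszulForm_hField_hField_vField (k : Fin n) :
    koszulForm g cov α β u (hField cov X) (hField cov Y) (vField cov k Z) =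
      -(α (normSq g u k) * g.inner u.proj
        (curvatureAt cov u.proj (X u.proj) (Y u.proj) (u.vec k)) (Z u.proj)) := by
  simp only [koszulForm]
  rw [mvfderiv_metric_hField_vField, mvfderiv_metric_hField_vField,
    mvfderiv_metric_hField_hField hcov hX hY _ rfl rfl rfl rfl,
    mlieBracket_hField_vField hcov hX hZ, mlieBracket_hField_vField hcov hY hZ]
  have h1 := congrArg Prod.snd (split_mlieBracket_hField_hField hcov hX hY)
  have h2 := inner_curvatureAt_skew hcov (X u.proj) (Y u.proj) (u.vec k) (u.vec k)
  simp only [hField, vField, metric_hLift_right, metric_vLift_right, split_vLift] at h1 ⊢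
  rw [h1]
  simp only [map_neg, neg_apply, map_zero, zero_apply]
  have h3 : g.inner u.proj (curvatureAt cov u.proj (X u.proj) (Y u.proj) (u.vec k)) (u.vec k) = 0 :=
    by linarith
  rw [h3]
  ring

theorem koszulForm_hField_vField_hField (i : Fin n) :
    koszulForm g cov α β u (hField cov X) (vField cov i Y) (hField cov Z) =
      α (normSq g u i) * g.inner u.proj
        (curvatureAt cov u.proj (u.vec i) (Y u.proj) (X u.proj)) (Z u.proj) := by
  simp only [koszulForm]
  rw [mvfderiv_metric_vField_hField, mvfderiv_metric_hField_vField,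
    mvfderiv_metric_hField_hField hcov hX hZ _ rfl rfl rfl rfl,
    mlieBracket_hField_vField hcov hX hY, mlieBracket_vField_hField hcov hY hZ]
  have h1 := congrArg Prod.snd (split_mlieBracket_hField_hField hcov hX hZ)
  have h2 := inner_curvatureAt_skew hcov (X u.proj) (Z u.proj) (u.vec i) (u.vec i)
  simp only [hField, vField, metric_hLift_right, metric_vLift_right, split_vLift, map_neg,
    Prod.fst_neg] at h1 ⊢
  rw [h1, inner_curvatureAt_pair_symm hcov (u.vec i)]
  simp only [map_neg, neg_apply, map_zero, zero_apply]
  have h3 : g.inner u.proj (curvatureAt cov u.proj (X u.proj) (Z u.proj) (u.vec i)) (u.vec i) = 0 :=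
    by linarith
  rw [h3]
  ring

theorem koszulForm_hField_vField_vField (i : Fin n) (hα : DifferentiableAt ℝ α (normSq g u i))
    (hβ : DifferentiableAt ℝ β (normSq g u i)) :
    koszulForm g cov α β u (hField cov X) (vField cov i Y) (vField cov i Z) =
      2 * (α (normSq g u i) * g.inner u.proj (cov Y u.proj (X u.proj)) (Z u.proj) +
        β (normSq g u i) * (g.inner u.proj (cov Y u.proj (X u.proj)) (u.vec i) *
          g.inner u.proj (Z u.proj) (u.vec i))) := by
  simp only [koszulForm]
  rw [mvfderiv_metric_hField_vField, mvfderiv_metric_hField_vField,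
    mvfderiv_metric_vField_vField hcov i hα hβ hY hZ (hField cov X u)
      (a := cov Y u.proj (X u.proj)) (b := cov Z u.proj (X u.proj)) (κ := 0)
      (by rw [hField, split_hLift]) (by rw [hField, split_hLift])
      (by rw [hField, split_hLift]; rfl) rfl rfl,
    mlieBracket_hField_vField hcov hX hY, mlieBracket_hField_vField hcov hX hZ,
    mlieBracket_vField_vField hcov hY hZ]
  simp only [hField, vField, metric_hLift_right, metric_vLift_right, split_vLift,
    Pi.single_eq_same, map_zero, Prod.fst_zero, zero_apply]
  rw [g.symm _ (cov Z u.proj (X u.proj)) (Y u.proj)]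
  ring

theorem koszulForm_hField_vField_vField_of_ne {i k : Fin n} (hik : i ≠ k) :
    koszulForm g cov α β u (hField cov X) (vField cov i Y) (vField cov k Z) = 0 := by
  simp only [koszulForm]
  rw [mvfderiv_metric_hField_vField, mvfderiv_metric_hField_vField,
    mvfderiv_metric_vField_vField_of_ne _ _ hik,
    mlieBracket_hField_vField hcov hX hY, mlieBracket_hField_vField hcov hX hZ,
    mlieBracket_vField_vField hcov hY hZ]
  simp only [hField, vField, metric_hLift_right, metric_vLift_right, split_vLift,
    Pi.single_eq_of_ne hik, Pi.single_eq_of_ne hik.symm, map_zero, Prod.fst_zero, zero_apply]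
  ring

theorem koszulForm_vField_vField_hField_of_ne {i j : Fin n} (hij : i ≠ j) :
    koszulForm g cov α β u (vField cov i X) (vField cov j Y) (hField cov Z) = 0 := by
  simp only [koszulForm]
  rw [mvfderiv_metric_vField_hField, mvfderiv_metric_vField_hField,
    mvfderiv_metric_vField_vField_of_ne _ _ hij,
    mlieBracket_vField_hField hcov hX hZ, mlieBracket_vField_hField hcov hY hZ,
    mlieBracket_vField_vField hcov hX hY]
  simp only [hField, vField, metric_hLift_right, metric_vLift_right, split_vLift, map_neg,
    Prod.snd_neg, Pi.neg_apply,
    Pi.single_eq_of_ne hij, Pi.single_eq_of_ne hij.symm, map_zero, Prod.fst_zero, zero_apply,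
    neg_zero]
  ring

theorem koszulForm_vField_vField_hField (i : Fin n) (hα : DifferentiableAt ℝ α (normSq g u i))
    (hβ : DifferentiableAt ℝ β (normSq g u i)) :
    koszulForm g cov α β u (vField cov i X) (vField cov i Y) (hField cov Z) = 0 := by
  simp only [koszulForm]
  rw [mvfderiv_metric_vField_hField, mvfderiv_metric_vField_hField,
    mvfderiv_metric_vField_vField hcov i hα hβ hX hY (hField cov Z u)
      (a := cov X u.proj (Z u.proj)) (b := cov Y u.proj (Z u.proj)) (κ := 0)
      (by rw [hField, split_hLift]) (by rw [hField, split_hLift])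
      (by rw [hField, split_hLift]; rfl) rfl rfl,
    mlieBracket_vField_hField hcov hX hZ, mlieBracket_vField_hField hcov hY hZ,
    mlieBracket_vField_vField hcov hX hY]
  simp only [hField, vField, metric_hLift_right, metric_vLift_right, split_vLift, map_neg,
    Prod.snd_neg, Pi.neg_apply, neg_apply, Pi.single_eq_same, map_zero, Prod.fst_zero, zero_apply]
  rw [g.symm _ (cov Y u.proj (Z u.proj)) (X u.proj)]
  ring

theorem koszulForm_vField_vField_vField_of_ne {i j k : Fin n} (hij : ¬(i = j ∧ j = k))
    (hα : ∀ i, DifferentiableAt ℝ α (normSq g u i))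
    (hβ : ∀ i, DifferentiableAt ℝ β (normSq g u i)) :
    koszulForm g cov α β u (vField cov i X) (vField cov j Y) (vField cov k Z) = 0 := by
  have key : ∀ {i j k : Fin n} {X Y Z : ∀ x : M, TangentSpace (𝓡 n) x},
      MDifferentiableAt (𝓡 n) (𝓡 n).tangent
        (fun y => (⟨y, X y⟩ : TangentBundle (𝓡 n) M)) u.proj →
      MDifferentiableAt (𝓡 n) (𝓡 n).tangent
        (fun y => (⟨y, Y y⟩ : TangentBundle (𝓡 n) M)) u.proj →
      MDifferentiableAt (𝓡 n) (𝓡 n).tangent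
        (fun y => (⟨y, Z y⟩ : TangentBundle (𝓡 n) M)) u.proj → ¬(i = j ∧ j = k) →
      mvfderiv (frameI n) (fun w => metric g cov α β w (vField cov i X w) (vField cov j Y w)) u
        (vField cov k Z u) = 0 := by
    intro i j k X Y Z hX hY hZ h
    rcases eq_or_ne i j with rfl | hne
    · exact mvfderiv_metric_vField_vField_vField_of_ne hcov hX hY (fun h' => h ⟨rfl, h'⟩)
        (hα i) (hβ i)
    · exact mvfderiv_metric_vField_vField_of_ne _ _ hne _
  simp only [koszulForm]
  rw [key hY hZ hX (fun h => hij ⟨h.1.trans h.2 |>.symm, h.1⟩),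
    key hX hZ hY (fun h => hij ⟨h.1.trans h.2, h.2.symm⟩), key hX hY hZ hij,
    mlieBracket_vField_vField hcov hX hY, mlieBracket_vField_vField hcov hX hZ,
    mlieBracket_vField_vField hcov hY hZ]
  simp [vField, metric_vLift_right]

theorem koszulForm_vField_vField_vField (i : Fin n) (hα : DifferentiableAt ℝ α (normSq g u i))
    (hβ : DifferentiableAt ℝ β (normSq g u i)) :
    koszulForm g cov α β u (vField cov i X) (vField cov i Y) (vField cov i Z) =
      2 * deriv α (normSq g u i) *
        (g.inner u.proj (X u.proj) (u.vec i) * g.inner u.proj (Y u.proj) (Z u.proj) +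
          g.inner u.proj (Y u.proj) (u.vec i) * g.inner u.proj (X u.proj) (Z u.proj) -
          g.inner u.proj (Z u.proj) (u.vec i) * g.inner u.proj (X u.proj) (Y u.proj)) +
      2 * deriv β (normSq g u i) * (g.inner u.proj (X u.proj) (u.vec i) *
        g.inner u.proj (Y u.proj) (u.vec i) * g.inner u.proj (Z u.proj) (u.vec i)) +
      2 * β (normSq g u i) * (g.inner u.proj (X u.proj) (Y u.proj) *
        g.inner u.proj (Z u.proj) (u.vec i)) := by
  simp only [koszulForm]
  have hcv : ∀ V W : ∀ x : M, TangentSpace (𝓡 n) x,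
      cov V u.proj (split cov u (vField cov i W u)).1 = 0 := fun V W => by
    rw [vField, split_vLift, map_zero]
  have hk : ∀ W : ∀ x : M, TangentSpace (𝓡 n) x,
      (split cov u (vField cov i W u)).2 i = W u.proj := fun W => by
    rw [vField, split_vLift]; exact Pi.single_eq_same i _
  rw [mvfderiv_metric_vField_vField hcov i hα hβ hY hZ _ (hcv Y X) (hcv Z X) (hk X) rfl rfl,
    mvfderiv_metric_vField_vField hcov i hα hβ hX hZ _ (hcv X Y) (hcv Z Y) (hk Y) rfl rfl,
    mvfderiv_metric_vField_vField hcov i hα hβ hX hY _ (hcv X Z) (hcv Y Z) (hk Z) rfl rfl,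
    mlieBracket_vField_vField hcov hX hY, mlieBracket_vField_vField hcov hX hZ,
    mlieBracket_vField_vField hcov hY hZ]
  simp only [vField, metric_vLift_right, map_zero, Prod.snd_zero, Pi.zero_apply, zero_apply]
  rw [g.symm _ (Y u.proj) (X u.proj), g.symm _ (Z u.proj) (X u.proj),
    g.symm _ (Z u.proj) (Y u.proj)]
  ring

end FrameBundle

/-! ### The Levi-Civita connection of the frame bundle -/

namespace FrameBundle

/-- The covariant derivative of `Y^{v,i}` along `X^{v,i}` satisfies the Koszul formula. Here `A, B`
are the values of `α, β` and `A', B'` those of the derivatives at `t = |u_i|^2`, and the inner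
products are `a = g(X, u_i)`, `b = g(Y, u_i)`, `z = g(Z, u_i)`, `p = g(X, Y)`, `q = g(Y, Z)`,
`r = g(X, Z)`. -/
theorem vertical_coefficient_identity {A B A' B' t : ℝ} (hA : A ≠ 0) (hAB : A + t * B ≠ 0)
    (a b z p q r : ℝ) :
    2 * A' * (a * q + b * r - z * p) + 2 * B' * (a * b * z) + 2 * B * (p * z) =
      2 * (A * (A' / A * (a * q + b * r) +
          ((B' * A - 2 * A' * B) / (A * (A + t * B)) * a * b + (B - A') / (A + t * B) * p) * z) +
        B * ((A' / A * (a * b + b * a) +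
          ((B' * A - 2 * A' * B) / (A * (A + t * B)) * a * b + (B - A') / (A + t * B) * p) * t) *
            z)) := by
  obtain ⟨S, hS⟩ : ∃ S, S = A + t * B := ⟨_, rfl⟩
  rw [← hS] at hAB ⊢
  obtain ⟨c, hc⟩ : ∃ c, c = (B' * A - 2 * A' * B) / (A * S) * a * b + (B - A') / S * p := ⟨_, rfl⟩
  obtain ⟨k, hk⟩ : ∃ k, k = A' / A := ⟨_, rfl⟩
  have hkA : k * A = A' := by rw [hk, div_mul_cancel₀ _ hA]
  have hcS : c * S = (B' - 2 * k * B) * (a * b) + (B - A') * p := by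
    rw [hc, hk]
    field_simp
  rw [← hc, ← hk]
  linear_combination -2 * (a * q + b * r) * hkA - 2 * z * hcS + 2 * c * z * hS

variable {n : ℕ} {M : Type*} [TopologicalSpace M]
  [ChartedSpace (EuclideanSpace ℝ (Fin n)) M] [IsManifold (𝓡 n) ∞ M]
  {g : ContMDiffRiemannianMetric (𝓡 n) ∞ (EuclideanSpace ℝ (Fin n))
      (TangentSpace (𝓡 n) : M → Type _)}
  {cov : CovariantDerivative (𝓡 n) (EuclideanSpace ℝ (Fin n))
      (TangentSpace (𝓡 n) : M → Type _)}
  {nablaBar : CovariantDerivative (frameI n) (FrameModel n)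
      (TangentSpace (frameI n) : FrameBundle n M → Type _)}
  {u : FrameBundle n M} {α β : ℝ → ℝ} {X Y : ∀ x : M, TangentSpace (𝓡 n) x}
  (hcov : IsLeviCivita (fun x v w => g.inner x v w) cov)
  (hα_pos : ∀ t : ℝ, 0 < t → 0 < α t) (hαβ_pos : ∀ t : ℝ, 0 < t → 0 < α t + t * β t)
  (hbar : IsLeviCivita (metric g cov α β) nablaBar)
  (hX : MDifferentiableAt (𝓡 n) (𝓡 n).tangent
      (fun y => (⟨y, X y⟩ : TangentBundle (𝓡 n) M)) u.proj)
  (hY : MDifferentiableAt (𝓡 n) (𝓡 n).tangent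
      (fun y => (⟨y, Y y⟩ : TangentBundle (𝓡 n) M)) u.proj)
include hcov hα_pos hαβ_pos hbar hX hY

theorem nablaBar_hField_hField :
    nablaBar (hField cov Y) u (hField cov X u) =
      hLift cov u (cov Y u.proj (X u.proj)) -
        (1 / 2 : ℝ) • ∑ i, vLift cov i u
          (curvatureAt cov u.proj (X u.proj) (Y u.proj) (u.vec i)) := by
  -- the decomposition of the right-hand side
  have hD : split cov u (hLift cov u (cov Y u.proj (X u.proj)) -
        (1 / 2 : ℝ) • ∑ i, vLift cov i u
          (curvatureAt cov u.proj (X u.proj) (Y u.proj) (u.vec i))) =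
      (cov Y u.proj (X u.proj), fun k => -((1 / 2 : ℝ) •
        curvatureAt cov u.proj (X u.proj) (Y u.proj) (u.vec k))) := by
    rw [map_sub, map_smul, map_sum]
    simp only [split_hLift, split_vLift]
    refine Prod.ext ?_ (funext fun k => ?_)
    · simp [Prod.fst_sum]
    · simp [Prod.snd_sum, Finset.sum_apply, Finset.sum_pi_single]
  refine nablaBar_eq hcov hα_pos hαβ_pos hbar (mdifferentiableAt_hField hcov hX)
    (mdifferentiableAt_hField hcov hY) (fun Z hZ => ?_) fun k Z hZ => ?_
  · rw [koszulForm_hField_hField_hField hcov hX hY hZ, hField, metric_hLift_right, hD]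
  · have h2 := inner_curvatureAt_skew hcov (X u.proj) (Y u.proj) (u.vec k) (u.vec k)
    have h3 : g.inner u.proj (curvatureAt cov u.proj (X u.proj) (Y u.proj) (u.vec k)) (u.vec k) =
      0 := by linarith
    rw [koszulForm_hField_hField_vField hcov hX hY hZ, vField, metric_vLift_right, hD]
    simp only [map_neg, map_smul, neg_apply, smul_apply, smul_eq_mul, h3]
    ring

variable (hα : ∀ i, DifferentiableAt ℝ α (normSq g u i))
  (hβ : ∀ i, DifferentiableAt ℝ β (normSq g u i))
include hα hβ

theorem nablaBar_vField_hField (i : Fin n) :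
    nablaBar (vField cov i Y) u (hField cov X u) =
      (α (normSq g u i) / 2) • hLift cov u
          (curvatureAt cov u.proj (u.vec i) (Y u.proj) (X u.proj)) +
        vLift cov i u (cov Y u.proj (X u.proj)) := by
  have hD : split cov u ((α (normSq g u i) / 2) • hLift cov u
          (curvatureAt cov u.proj (u.vec i) (Y u.proj) (X u.proj)) +
        vLift cov i u (cov Y u.proj (X u.proj))) =
      ((α (normSq g u i) / 2) • curvatureAt cov u.proj (u.vec i) (Y u.proj) (X u.proj),
        Pi.single i (cov Y u.proj (X u.proj))) := by
    rw [map_add, map_smul]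
    simp only [split_hLift, split_vLift]
    refine Prod.ext ?_ ?_ <;> simp
  refine nablaBar_eq hcov hα_pos hαβ_pos hbar (mdifferentiableAt_hField hcov hX)
    (mdifferentiableAt_vField hcov hY i) (fun Z hZ => ?_) fun k Z hZ => ?_
  · rw [koszulForm_hField_vField_hField hcov hX hY hZ, hField, metric_hLift_right, hD]
    simp only [map_smul, smul_apply, smul_eq_mul]
    ring
  · rw [vField, metric_vLift_right, hD]
    rcases eq_or_ne i k with rfl | hik
    · rw [koszulForm_hField_vField_vField hcov hX hY hZ i (hα i) (hβ i)]
      simp only [Pi.single_eq_same]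
    · rw [koszulForm_hField_vField_vField_of_ne hcov hX hY hZ hik]
      simp [Pi.single_eq_of_ne hik.symm]

/-- This follows from the covariant derivative of `X^{v,i}` in the direction `Y^h`, because the
torsion vanishes. -/
theorem nablaBar_hField_vField (i : Fin n) :
    nablaBar (hField cov Y) u (vField cov i X u) =
      (α (normSq g u i) / 2) • hLift cov u
          (curvatureAt cov u.proj (u.vec i) (X u.proj) (Y u.proj)) := by
  have h1 := hbar.torsion_free (vField cov i X) (hField cov Y) u
    (mdifferentiableAt_vField hcov hX i) (mdifferentiableAt_hField hcov hY)
  rw [mlieBracket_vField_hField hcov hX hY,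
    nablaBar_vField_hField hcov hα_pos hαβ_pos hbar hY hX hα hβ, sub_eq_iff_eq_add] at h1
  rw [h1]
  abel

theorem nablaBar_vField_vField_of_ne {i j : Fin n} (hij : i ≠ j) :
    nablaBar (vField cov j Y) u (vField cov i X u) = 0 := by
  refine nablaBar_eq hcov hα_pos hαβ_pos hbar (mdifferentiableAt_vField hcov hX i)
    (mdifferentiableAt_vField hcov hY j) (fun Z hZ => ?_) fun k Z hZ => ?_
  · rw [koszulForm_vField_vField_hField_of_ne hcov hX hY hZ hij]
    simp [hField, metric_hLift_right]
  · rw [koszulForm_vField_vField_vField_of_ne hcov hX hY hZ (fun h => hij h.1) hα hβ]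
    simp [vField, metric_vLift_right]

set_option maxHeartbeats 1000000 in
theorem nablaBar_vField_vField (i : Fin n) :
    let t := normSq g u i
    nablaBar (vField cov i Y) u (vField cov i X u) =
      (deriv α t / α t) •
        (g.inner u.proj (X u.proj) (u.vec i) • vField cov i Y u +
          g.inner u.proj (Y u.proj) (u.vec i) • vField cov i X u) +
      ((deriv β t * α t - 2 * deriv α t * β t) / (α t * (α t + t * β t)) *
          g.inner u.proj (X u.proj) (u.vec i) * g.inner u.proj (Y u.proj) (u.vec i) +
        (β t - deriv α t) / (α t + t * β t) *
          g.inner u.proj (X u.proj) (Y u.proj)) • canonicalField cov i u := by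
  intro t
  have ht : 0 < t := normSq_pos g u i
  have hαt := (hα_pos t ht).ne'
  have hαβt := (hαβ_pos t ht).ne'
  set p := g.inner u.proj (X u.proj) (Y u.proj)
  set a := g.inner u.proj (X u.proj) (u.vec i)
  set b := g.inner u.proj (Y u.proj) (u.vec i)
  set c := (deriv β t * α t - 2 * deriv α t * β t) / (α t * (α t + t * β t)) * a * b +
    (β t - deriv α t) / (α t + t * β t) * p
  have hD : split cov u ((deriv α t / α t) • (a • vField cov i Y u + b • vField cov i X u) +
      c • canonicalField cov i u) = (0, Pi.single i ((deriv α t / α t) •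
        (a • Y u.proj + b • X u.proj) + c • u.vec i)) := by
    simp only [map_add, map_smul, vField, canonicalField, split_vLift]
    refine Prod.ext (by simp) ?_
    simp only [Prod.snd_add, Prod.smul_snd, ← Pi.single_smul, ← Pi.single_add]
  refine nablaBar_eq hcov hα_pos hαβ_pos hbar (mdifferentiableAt_vField hcov hX i)
    (mdifferentiableAt_vField hcov hY i) (fun Z hZ => ?_) fun k Z hZ => ?_
  · rw [koszulForm_vField_vField_hField hcov hX hY hZ i (hα i) (hβ i), hField,
      metric_hLift_right, hD]
    simp
  · have hZu : vField cov k Z u = vLift cov k u (Z u.proj) := rfl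
    rw [hZu, metric_vLift_right, hD]
    rcases eq_or_ne i k with rfl | hik
    · rw [koszulForm_vField_vField_vField hcov hX hY hZ i (hα i) (hβ i)]
      simp only [Pi.single_eq_same, map_add, map_smul, add_apply, smul_apply, smul_eq_mul]
      have htu : g.inner u.proj (u.vec i) (u.vec i) = t := rfl
      rw [g.symm u.proj (u.vec i) (Z u.proj), htu]
      change 2 * deriv α t * (a * _ + b * _ - _ * p) + 2 * deriv β t * (a * b * _) +
        2 * β t * (p * _) = 2 * (α t * (deriv α t / α t * (a * _ + b * _) + c * _) +
        β t * ((deriv α t / α t * (a * b + b * a) + c * t) * _))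
      exact vertical_coefficient_identity hαt hαβt ..
    · rw [koszulForm_vField_vField_vField_of_ne hcov hX hY hZ (fun h => hik h.2) hα hβ]
      simp [Pi.single_eq_of_ne hik.symm]

end FrameBundle

end

theorem mainTheorem2 {n : ℕ} {M : Type*} [TopologicalSpace M] [T2Space M]
    [ChartedSpace (EuclideanSpace ℝ (Fin n)) M] [IsManifold (𝓡 n) ∞ M]
    (g : ContMDiffRiemannianMetric (𝓡 n) ∞ (EuclideanSpace ℝ (Fin n))
      (TangentSpace (𝓡 n) : M → Type _))
    (nabla : CovariantDerivative (𝓡 n) (EuclideanSpace ℝ (Fin n))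
      (TangentSpace (𝓡 n) : M → Type _))
    (hnabla : IsLeviCivita (fun x v w => g.inner x v w) nabla)
    (α β : ℝ → ℝ)
    (hα : ContDiffOn ℝ ∞ α (Set.Ici 0)) (hβ : ContDiffOn ℝ ∞ β (Set.Ici 0))
    (hα_pos : ∀ t : ℝ, 0 < t → 0 < α t) (hαβ_pos : ∀ t : ℝ, 0 < t → 0 < α t + t * β t)
    (nablaBar : CovariantDerivative (frameI n) (FrameModel n)
      (TangentSpace (frameI n) : FrameBundle n M → Type _))
    (hnablaBar : IsLeviCivita (FrameBundle.metric g nabla α β) nablaBar)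
    (X Y : ∀ x : M, TangentSpace (𝓡 n) x)
    (hX : ContMDiff (𝓡 n) (𝓡 n).tangent ∞ (fun x => (⟨x, X x⟩ : TangentBundle (𝓡 n) M)))
    (hY : ContMDiff (𝓡 n) (𝓡 n).tangent ∞ (fun x => (⟨x, Y x⟩ : TangentBundle (𝓡 n) M)))
    (u : FrameBundle n M) :
    (nablaBar (FrameBundle.hField nabla Y) u (FrameBundle.hField nabla X u) =
      FrameBundle.hLift nabla u (nabla Y u.proj (X u.proj)) -
        (1 / 2 : ℝ) • ∑ i, FrameBundle.vLift nabla i u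
          (curvatureAt nabla u.proj (X u.proj) (Y u.proj) (u.vec i))) ∧
    (∀ i : Fin n,
      nablaBar (FrameBundle.vField nabla i Y) u (FrameBundle.hField nabla X u) =
        (α (FrameBundle.normSq g u i) / 2) • FrameBundle.hLift nabla u
          (curvatureAt nabla u.proj (u.vec i) (Y u.proj) (X u.proj)) +
        FrameBundle.vLift nabla i u (nabla Y u.proj (X u.proj))) ∧
    (∀ i : Fin n,
      nablaBar (FrameBundle.hField nabla Y) u (FrameBundle.vField nabla i X u) =
        (α (FrameBundle.normSq g u i) / 2) • FrameBundle.hLift nabla u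
          (curvatureAt nabla u.proj (u.vec i) (X u.proj) (Y u.proj))) ∧
    (∀ i j : Fin n, i ≠ j →
      nablaBar (FrameBundle.vField nabla j Y) u (FrameBundle.vField nabla i X u) = 0) ∧
    (∀ i : Fin n,
      let t := FrameBundle.normSq g u i
      nablaBar (FrameBundle.vField nabla i Y) u (FrameBundle.vField nabla i X u) =
        (deriv α t / α t) •
          (g.inner u.proj (X u.proj) (u.vec i) • FrameBundle.vField nabla i Y u +
            g.inner u.proj (Y u.proj) (u.vec i) • FrameBundle.vField nabla i X u) +
        ((deriv β t * α t - 2 * deriv α t * β t) / (α t * (α t + t * β t)) *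
            g.inner u.proj (X u.proj) (u.vec i) * g.inner u.proj (Y u.proj) (u.vec i) +
          (β t - deriv α t) / (α t + t * β t) *
            g.inner u.proj (X u.proj) (Y u.proj)) •
          FrameBundle.canonicalField nabla i u) := by
  have hX' := (hX u.proj).mdifferentiableAt (by simp)
  have hY' := (hY u.proj).mdifferentiableAt (by simp)
  -- `u_i ≠ 0`, so `|u_i|^2` is an interior point of `[0, ∞)`
  have hdα : ∀ i, DifferentiableAt ℝ α (FrameBundle.normSq g u i) := fun i =>
    (hα.contDiffAt (Ici_mem_nhds (FrameBundle.normSq_pos g u i))).differentiableAt (by simp)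
  have hdβ : ∀ i, DifferentiableAt ℝ β (FrameBundle.normSq g u i) := fun i =>
    (hβ.contDiffAt (Ici_mem_nhds (FrameBundle.normSq_pos g u i))).differentiableAt (by simp)
  exact ⟨FrameBundle.nablaBar_hField_hField hnabla hα_pos hαβ_pos hnablaBar hX' hY',
    FrameBundle.nablaBar_vField_hField hnabla hα_pos hαβ_pos hnablaBar hX' hY' hdα hdβ,
    FrameBundle.nablaBar_hField_vField hnabla hα_pos hαβ_pos hnablaBar hX' hY' hdα hdβ,
    fun i j hij => FrameBundle.nablaBar_vField_vField_of_ne hnabla hα_pos hαβ_pos hnablaBar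
      hX' hY' hdα hdβ hij,
    FrameBundle.nablaBar_vField_vField hnabla hα_pos hαβ_pos hnablaBar hX' hY' hdα hdβ⟩
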